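/- Let $\nu>0$ and $T>0$. Consider, for an initial datum $u_0\in L^2(0,1)$, the coupled forward–backward viscous Burgers problem with nudging coefficients $K,K'$ and observations $u_{obs}$, $$(F)\quad \partial_t u-\nu\,\partial_{xx}u+u\,\partial_x u=-K(u-u_{obs}),\qquad u|_{x=0}=u|_{x=1}=0,\qquad u|_{t=0}=u_0,$$ $$(B)\quad \partial_t \tilde u-\nu\,\partial_{xx}\tilde u+\tilde u\,\partial_x \tilde u=K'(\tilde u-u_{obs}),\qquad \tilde u|_{x=0}=\tilde u|_{x=1}=0,\qquad \tilde u|_{t=T}=u(T),$$ on $[0,T]\times[0,1]$. A solution is a pair $(u,\tilde u)$ of elements of $C([0,T];L^2(0,1))$, each of which is, for $t>0$, represented by a function that is continuous on $(0,T]\times[0,1]$, vanishes at $x=0$ and $x=1$, has continuous derivatives $\partial_t,\partial_x,\partial_{xx}$ on $(0,T)\times(0,1)$, and satisfies its equation pointwise there; the conditions at $t=0$ and $t=T$ are equalities in $L^2(0,1)$. If $K=K'\equiv 0$ on $[0,T]\times[0,1]$, then this problem is well-posed in the sense of Hadamard: for every $u_0\in L^2(0,1)$ there exists a unique solution $(u,\tilde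 u)$, and the map $u_0\mapsto(u,\tilde u)$ is continuous from $L^2(0,1)$ to $C([0,T];L^2(0,1))^2$ (with uniform convergence in time). Moreover $u=\tilde u$. -/

import Mathlib

open MeasureTheory Set

/-- The real Hilbert space `L²(0,1)`. -/
abbrev L2Unit : Type := Lp ℝ 2 (volume.restrict (Ioo (0 : ℝ) 1))

/-- The space `C([0,T]; L²(0,1))`, with the topology of uniform convergence on `[0,T]`. -/
abbrev Trajectory (T : ℝ) : Type := C(Icc (0 : ℝ) T, L2Unit)

/-- `w` (a function of `t` and `x`) is a classical solution, for positive times, of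
`∂ₜw - ν ∂ₓₓw + w ∂ₓw = -k (w - obs)` with `w = 0` at `x = 0` and `x = 1`:
it is continuous on `(0,T] × [0,1]` and vanishes at the two end points, its derivatives
`∂ₜw`, `∂ₓw`, `∂ₓₓw` exist and are continuous on `(0,T) × (0,1)`, and the equation holds there. -/
structure IsClassicalNudgedBurgers (ν T : ℝ) (k obs w : ℝ → ℝ → ℝ) : Prop where
  continuousOn : ContinuousOn (fun p : ℝ × ℝ => w p.1 p.2) (Ioc 0 T ×ˢ Icc 0 1)
  left_boundary : ∀ t ∈ Ioc 0 T, w t 0 = 0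
  right_boundary : ∀ t ∈ Ioc 0 T, w t 1 = 0
  differentiableAt_t : ∀ t ∈ Ioo 0 T, ∀ x ∈ Ioo (0 : ℝ) 1, DifferentiableAt ℝ (fun s => w s x) t
  differentiableAt_x : ∀ t ∈ Ioo 0 T, ∀ x ∈ Ioo (0 : ℝ) 1, DifferentiableAt ℝ (w t) x
  differentiableAt_xx : ∀ t ∈ Ioo 0 T, ∀ x ∈ Ioo (0 : ℝ) 1, DifferentiableAt ℝ (deriv (w t)) x
  continuousOn_t :
    ContinuousOn (fun p : ℝ × ℝ => deriv (fun s => w s p.2) p.1) (Ioo 0 T ×ˢ Ioo 0 1)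
  continuousOn_x : ContinuousOn (fun p : ℝ × ℝ => deriv (w p.1) p.2) (Ioo 0 T ×ˢ Ioo 0 1)
  continuousOn_xx :
    ContinuousOn (fun p : ℝ × ℝ => deriv (deriv (w p.1)) p.2) (Ioo 0 T ×ˢ Ioo 0 1)
  equation : ∀ t ∈ Ioo 0 T, ∀ x ∈ Ioo (0 : ℝ) 1,
    deriv (fun s => w s x) t - ν * deriv (deriv (w t)) x + w t x * deriv (w t) x
      = -(k t x) * (w t x - obs t x)

/-- `u ∈ C([0,T]; L²(0,1))` solves the nudged viscous Burgers equation with homogeneous Dirichlet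
boundary conditions: for positive times it is represented by a classical solution. -/
def SolvesNudgedBurgers (ν T : ℝ) (k obs : ℝ → ℝ → ℝ) (u : Trajectory T) : Prop :=
  ∃ w : ℝ → ℝ → ℝ, IsClassicalNudgedBurgers ν T k obs w ∧
    ∀ t : Icc (0 : ℝ) T, 0 < (t : ℝ) →
      (u t : ℝ → ℝ) =ᵐ[volume.restrict (Ioo (0 : ℝ) 1)] w t

/-- One step of the back and forth nudging problem for the viscous Burgers equation, with datum
`u₀`: the first component `u` of the pair solves the forward equation (right-hand side
`-K (u - obs)`) with `u(0) = u₀`, the second component `ũ` solves the backward equation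
(right-hand side `K' (ũ - obs)`) with `ũ(T) = u(T)`. -/
structure IsBFNBurgersSolution (ν T : ℝ) (hT : 0 ≤ T) (K K' obs : ℝ → ℝ → ℝ)
    (u₀ : L2Unit) (p : Trajectory T × Trajectory T) : Prop where
  forward : SolvesNudgedBurgers ν T K obs p.1
  initial : p.1 ⟨0, left_mem_Icc.2 hT⟩ = u₀
  backward : SolvesNudgedBurgers ν T (fun t x => -(K' t x)) obs p.2
  final : p.2 ⟨T, right_mem_Icc.2 hT⟩ = p.1 ⟨T, right_mem_Icc.2 hT⟩

/-- Well-posedness in the sense of Hadamard of a problem `P` with data in `D` and unknown in `X`: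
every datum has exactly one solution, and the solution depends continuously on the datum. -/
def HadamardWellPosed {D X : Type*} [TopologicalSpace D] [TopologicalSpace X]
    (P : D → X → Prop) : Prop :=
  (∀ d, ∃! x, P d x) ∧ ∀ S : D → X, (∀ d, P d (S d)) → Continuous S

/-! ### Continuous functions acting on `L²(0,1)` and primitives -/

/-! Once the nudging terms vanish, the two equations are the same viscous Burgers equation,
prescribed at `t = 0` for one unknown and at `t = T` for the other. Existence for the backward
problem is free, since the forward solution itself solves it. The real content is a forward solution
depending continuously on the datum, together with uniqueness both forward and backward in time.
Everything rests on the Cole–Hopf transform `φ = exp (κ ∫₀ˣ u)` with `κ = -1/(2ν)`.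

Uniqueness. Formally `φ` solves the Neumann heat equation up to a factor depending on time only, so
the ratio of its `n`-th cosine coefficient to the zeroth one, multiplied by `exp (ν n² π² t)`, is
constant in time. A classical solution need not have derivatives up to `x = 0` and `x = 1`, so the
computation is made on `[a, b] ⊂ (0, 1)` with base point `a`. There the ratio removes the
uncontrolled flux at `a`, and the remaining boundary terms contain only `w` and sines at `a` and
`b`, never `∂ₓw`; they vanish as `a → 0`, `b → 1` (`hasDerivAt_coleHopfQuotient`,
`abs_coleHopfQuotient_sub_le`). Continuity in `L²` extends the conservation law to the closed
interval `[0, T]` (`SolvesNudgedBurgers.exp_mul_normCoeff_eq`). The ratios determine `u(t)`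
(`eq_of_forall_normCoeff_eq`), so a trajectory is determined by its value at any single time,
initial or final (`eq_of_apply_eq`).

Existence. The heat flow is applied to `∂ₓφ = κ φ u`, an `L²` function expanded in sines;
integrating gives `φ(t)` in `C([0,1])`, continuous down to `t = 0`. A minimum principle on the
circle of length 2 keeps `φ` positive (`heatSeries_neumannCoeff_pos`), and `u = κ⁻¹ ∂ₓφ / φ` is the
solution. Each operation is continuous jointly in time and datum, which yields continuous dependence
(`continuous_burgersTrajectory`). -/

instance isProbabilityMeasure_restrict_Ioo :
    IsProbabilityMeasure (volume.restrict (Ioo (0 : ℝ) 1)) :=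
  ⟨by simp⟩

/-- The extension of a continuous function on `[0,1]` to `ℝ`, constant outside `[0,1]`. -/
noncomputable def extendI (f : C(unitInterval, ℝ)) (x : ℝ) : ℝ :=
  f (projIcc 0 1 zero_le_one x)

lemma continuous_extendI (f : C(unitInterval, ℝ)) : Continuous (extendI f) :=
  f.continuous.comp continuous_projIcc

lemma extendI_of_mem (f : C(unitInterval, ℝ)) {x : ℝ} (hx : x ∈ Icc (0 : ℝ) 1) :
    extendI f x = f ⟨x, hx⟩ := by
  rw [extendI, projIcc_of_mem _ hx]

lemma abs_extendI_le (f : C(unitInterval, ℝ)) (x : ℝ) : |extendI f x| ≤ ‖f‖ :=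
  f.norm_coe_le_norm _

lemma memLp_extendI_mul (f : C(unitInterval, ℝ)) (g : L2Unit) :
    MemLp (fun x => extendI f x * g x) 2 (volume.restrict (Ioo (0 : ℝ) 1)) := by
  refine (Lp.memLp g).of_le_mul (c := ‖f‖)
    ((continuous_extendI f).aestronglyMeasurable.mul (Lp.aestronglyMeasurable g)) ?_
  filter_upwards with x
  rw [norm_mul]
  exact mul_le_mul_of_nonneg_right (abs_extendI_le f x) (norm_nonneg _)

/-- Multiplication of an element of `L²(0,1)` by a continuous function on `[0,1]`. -/
noncomputable def mulL2 : C(unitInterval, ℝ) →L[ℝ] L2Unit →L[ℝ] L2Unit :=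
  LinearMap.mkContinuous₂
    (LinearMap.mk₂ ℝ (fun f g => (memLp_extendI_mul f g).toLp)
      (fun f₁ f₂ g => by
        rw [← MemLp.toLp_add]
        exact MemLp.toLp_congr _ _ (Filter.Eventually.of_forall fun x => by simp [extendI, add_mul]))
      (fun c f g => by
        rw [← MemLp.toLp_const_smul]
        exact MemLp.toLp_congr _ _
          (Filter.Eventually.of_forall fun x => by simp [extendI, mul_assoc]))
      (fun f g₁ g₂ => by
        rw [← MemLp.toLp_add]
        refine MemLp.toLp_congr _ _ ?_
        filter_upwards [Lp.coeFn_add g₁ g₂] with x hx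
        rw [hx]
        exact mul_add _ _ _)
      (fun c f g => by
        rw [← MemLp.toLp_const_smul]
        refine MemLp.toLp_congr _ _ ?_
        filter_upwards [Lp.coeFn_smul c g] with x hx
        simp [hx, mul_left_comm])) 1 (fun f g => by
      rw [one_mul]
      refine Lp.norm_le_mul_norm_of_ae_le_mul ?_
      filter_upwards [(memLp_extendI_mul f g).coeFn_toLp] with x hx
      simp only [LinearMap.mk₂_apply]
      rw [hx, norm_mul]
      exact mul_le_mul_of_nonneg_right (abs_extendI_le f x) (norm_nonneg _))

lemma coeFn_mulL2 (f : C(unitInterval, ℝ)) (g : L2Unit) :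
    (mulL2 f g : ℝ → ℝ) =ᵐ[volume.restrict (Ioo (0 : ℝ) 1)] fun x => extendI f x * g x :=
  (memLp_extendI_mul f g).coeFn_toLp

lemma mulL2_mulL2 (f₁ f₂ : C(unitInterval, ℝ)) (g : L2Unit) :
    mulL2 f₁ (mulL2 f₂ g) = mulL2 (f₁ * f₂) g := by
  refine Lp.ext ?_
  filter_upwards [coeFn_mulL2 f₁ (mulL2 f₂ g), coeFn_mulL2 f₂ g, coeFn_mulL2 (f₁ * f₂) g]
    with x h₁ h₂ h₃
  rw [h₁, h₂, h₃, ← mul_assoc]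
  rfl

lemma mulL2_one (g : L2Unit) : mulL2 1 g = g := by
  refine Lp.ext ?_
  filter_upwards [coeFn_mulL2 1 g] with x h
  rw [h]
  simp [extendI]

/-- A continuous function on `[0,1]`, seen in `L²(0,1)`. -/
noncomputable def toL2 : C(unitInterval, ℝ) →L[ℝ] L2Unit :=
  mulL2.flip (MemLp.toLp (fun _ => (1 : ℝ)) (memLp_const 1))

lemma coeFn_toL2 (f : C(unitInterval, ℝ)) :
    (toL2 f : ℝ → ℝ) =ᵐ[volume.restrict (Ioo (0 : ℝ) 1)] extendI f := by
  have h := coeFn_mulL2 f (MemLp.toLp (fun _ => (1 : ℝ)) (memLp_const 1))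
  filter_upwards [h, (memLp_const (p := 2) (μ := volume.restrict (Ioo (0 : ℝ) 1)) (1 : ℝ)).coeFn_toLp]
    with x h₁ h₂
  change (mulL2 f _ : ℝ → ℝ) x = _
  rw [h₁, h₂, mul_one]

lemma mulL2_toL2 (f g : C(unitInterval, ℝ)) : mulL2 f (toL2 g) = toL2 (f * g) :=
  mulL2_mulL2 _ _ _

lemma denseRange_toL2 : DenseRange toL2 := by
  have h := BoundedContinuousFunction.toLp_denseRange (𝕜 := ℝ) (E := ℝ) (p := 2)
    (μ := volume.restrict (Ioo (0 : ℝ) 1)) (by simp)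
  refine h.mono ?_
  rintro _ ⟨f, rfl⟩
  refine ⟨f.toContinuousMap.comp ⟨Subtype.val, continuous_subtype_val⟩, ?_⟩
  refine Lp.ext ?_
  filter_upwards [coeFn_toL2 (f.toContinuousMap.comp ⟨Subtype.val, continuous_subtype_val⟩),
    BoundedContinuousFunction.coeFn_toLp (p := 2) (𝕜 := ℝ) (volume.restrict (Ioo (0 : ℝ) 1)) f,
    ae_restrict_mem measurableSet_Ioo] with x h₁ h₂ hx
  rw [h₁, h₂, extendI_of_mem _ (Ioo_subset_Icc_self hx)]
  rfl

lemma integrableOn_L2Unit (g : L2Unit) : IntegrableOn g (Ioo (0 : ℝ) 1) :=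
  (Lp.memLp g).integrable (by norm_num)

lemma intervalIntegrable_L2Unit (g : L2Unit) {a b : ℝ} (ha : a ∈ Icc (0 : ℝ) 1)
    (hb : b ∈ Icc (0 : ℝ) 1) : IntervalIntegrable g volume a b := by
  have h : IntegrableOn g (Icc (0 : ℝ) 1) := by
    rw [integrableOn_Icc_iff_integrableOn_Ioo]; exact integrableOn_L2Unit g
  exact (h.mono_set (uIcc_subset_Icc ha hb)).intervalIntegrable

lemma integral_norm_le_norm_L2Unit (g : L2Unit) : ∫ x in Ioo (0 : ℝ) 1, ‖g x‖ ≤ ‖g‖ := by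
  rw [integral_norm_eq_lintegral_enorm (Lp.aestronglyMeasurable g), Lp.norm_def,
    ← eLpNorm_one_eq_lintegral_enorm]
  exact ENNReal.toReal_mono (Lp.eLpNorm_ne_top g)
    (eLpNorm_le_eLpNorm_of_exponent_le (by norm_num) (Lp.aestronglyMeasurable g))

lemma intervalIntegral_congr_ae_Ioo {f g : ℝ → ℝ}
    (h : f =ᵐ[volume.restrict (Ioo (0 : ℝ) 1)] g) {a b : ℝ} (ha : a ∈ Icc (0 : ℝ) 1)
    (hb : b ∈ Icc (0 : ℝ) 1) : ∫ x in a..b, f x = ∫ x in a..b, g x := by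
  refine intervalIntegral.integral_congr_ae_restrict ?_
  rw [Measure.restrict_congr_set Ioo_ae_eq_Ioc] at h
  refine ae_restrict_of_ae_restrict_of_subset ?_ h
  exact Ioc_subset_Ioc (le_min ha.1 hb.1) (max_le ha.2 hb.2)

lemma continuous_primitive_L2Unit (g : L2Unit) :
    Continuous fun x : unitInterval => ∫ y in (0 : ℝ)..x, g y := by
  have h := intervalIntegral.continuousOn_primitive_interval' (μ := volume)
    (intervalIntegrable_L2Unit g (left_mem_Icc.2 zero_le_one) (right_mem_Icc.2 zero_le_one))
    (left_mem_uIcc)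
  rw [uIcc_of_le zero_le_one] at h
  exact continuousOn_iff_continuous_domRestrict.1 h

/-- The primitive `x ↦ ∫₀ˣ g` of `g ∈ L²(0,1)`, a continuous function on `[0,1]`. -/
noncomputable def primitive : L2Unit →L[ℝ] C(unitInterval, ℝ) :=
  LinearMap.mkContinuous
    { toFun := fun g => ⟨fun x => ∫ y in (0 : ℝ)..x, g y, continuous_primitive_L2Unit g⟩
      map_add' := fun f g => by
        ext x
        change ∫ y in (0 : ℝ)..x, (f + g) y = (∫ y in (0 : ℝ)..x, f y) + ∫ y in (0 : ℝ)..x, g y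
        rw [← intervalIntegral.integral_add
          (intervalIntegrable_L2Unit f (left_mem_Icc.2 zero_le_one) x.2)
          (intervalIntegrable_L2Unit g (left_mem_Icc.2 zero_le_one) x.2)]
        exact intervalIntegral_congr_ae_Ioo (Lp.coeFn_add f g) (left_mem_Icc.2 zero_le_one) x.2
      map_smul' := fun c g => by
        ext x
        change ∫ y in (0 : ℝ)..x, (c • g) y = c • ∫ y in (0 : ℝ)..x, g y
        rw [← intervalIntegral.integral_smul]
        exact intervalIntegral_congr_ae_Ioo (Lp.coeFn_smul c g) (left_mem_Icc.2 zero_le_one) x.2 }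
    1 (fun g => by
      rw [one_mul, ContinuousMap.norm_le _ (norm_nonneg _)]
      intro x
      refine (intervalIntegral.norm_integral_le_integral_norm x.2.1).trans ?_
      refine le_trans ?_ (integral_norm_le_norm_L2Unit g)
      rw [intervalIntegral.integral_of_le x.2.1, ← integral_Ioc_eq_integral_Ioo]
      refine setIntegral_mono_set ?_ (Filter.Eventually.of_forall fun _ => norm_nonneg _)
        (Ioc_subset_Ioc le_rfl x.2.2).eventuallyLE
      rw [integrableOn_Ioc_iff_integrableOn_Ioo]
      exact (integrableOn_L2Unit g).norm)

lemma primitive_apply (g : L2Unit) (x : unitInterval) :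
    primitive g x = ∫ y in (0 : ℝ)..x, g y := rfl

lemma primitive_toL2 (f : C(unitInterval, ℝ)) (x : unitInterval) :
    primitive (toL2 f) x = ∫ y in (0 : ℝ)..x, extendI f y :=
  intervalIntegral_congr_ae_Ioo (coeFn_toL2 f) (left_mem_Icc.2 zero_le_one) x.2

/-- The functional `f ↦ ∫₀¹ f(x) cos(nπx) dx`. -/
noncomputable def cosCoeff (n : ℕ) : C(unitInterval, ℝ) →L[ℝ] ℝ :=
  LinearMap.mkContinuous
    { toFun := fun f => ∫ x in (0 : ℝ)..1, extendI f x * Real.cos (n * Real.pi * x)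
      map_add' := fun f g => by
        rw [← intervalIntegral.integral_add]
        · simp [extendI, add_mul]
        all_goals
          refine Continuous.intervalIntegrable ?_ _ _
          exact (continuous_extendI _).mul (by fun_prop)
      map_smul' := fun c f => by
        simp [extendI, mul_assoc] }
    1 (fun f => by
      have h := intervalIntegral.norm_integral_le_of_norm_le_const (a := (0 : ℝ)) (b := 1)
        (f := fun x => extendI f x * Real.cos (n * Real.pi * x)) (C := ‖f‖) (fun x _ => by
          rw [norm_mul]
          calc _ ≤ ‖f‖ * 1 := mul_le_mul (abs_extendI_le f x) (Real.abs_cos_le_one _)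
                (abs_nonneg _) (norm_nonneg _)
            _ = _ := mul_one _)
      simpa using h)

lemma cosCoeff_apply (n : ℕ) (f : C(unitInterval, ℝ)) :
    cosCoeff n f = ∫ x in (0 : ℝ)..1, extendI f x * Real.cos (n * Real.pi * x) := rfl

lemma cosCoeff_zero_pos {f : C(unitInterval, ℝ)} (hf : ∀ x, 0 < f x) : 0 < cosCoeff 0 f := by
  rw [cosCoeff_apply]
  refine intervalIntegral.intervalIntegral_pos_of_pos
    (((continuous_extendI f).mul (by fun_prop)).intervalIntegrable _ _) (fun x => ?_) zero_lt_one
  have := hf (projIcc 0 1 zero_le_one x)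
  simpa [extendI] using this

/-! ### The Cole–Hopf transform -/

/-- The (unnormalised) Cole–Hopf transform `x ↦ exp (κ ∫₀ˣ g)`. -/
noncomputable def coleHopf (κ : ℝ) (g : L2Unit) : C(unitInterval, ℝ) :=
  (⟨Real.exp, Real.continuous_exp⟩ : C(ℝ, ℝ)).comp (κ • primitive g)

lemma coleHopf_apply (κ : ℝ) (g : L2Unit) (x : unitInterval) :
    coleHopf κ g x = Real.exp (κ * primitive g x) := rfl

lemma coleHopf_pos (κ : ℝ) (g : L2Unit) (x : unitInterval) : 0 < coleHopf κ g x :=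
  Real.exp_pos _

lemma continuous_coleHopf (κ : ℝ) : Continuous (coleHopf κ) :=
  (ContinuousMap.continuous_postcomp _).comp (primitive.continuous.const_smul κ)

/-- This is `φ' = κ φ g` in integrated form. For continuous `g` it is the fundamental theorem of
calculus; both sides are continuous in `g ∈ L²`, so density of continuous functions gives the rest.
-/
lemma coleHopf_eq (κ : ℝ) (g : L2Unit) :
    coleHopf κ g = 1 + primitive (κ • mulL2 (coleHopf κ g) g) := by
  have h₁ : Continuous fun g => 1 + primitive (κ • mulL2 (coleHopf κ g) g) := by
    have := (mulL2.isBoundedBilinearMap.continuous.comp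
      ((continuous_coleHopf κ).prodMk continuous_id))
    exact continuous_const.add (primitive.continuous.comp (this.const_smul κ))
  refine congrFun (denseRange_toL2.equalizer (continuous_coleHopf κ) h₁ (funext fun f => ?_)) g
  simp only [Function.comp_apply]
  ext x
  rw [mulL2_toL2, ← map_smul, ContinuousMap.add_apply, primitive_toL2, coleHopf_apply,
    primitive_toL2]
  have hd : ∀ y ∈ uIcc (0 : ℝ) x, HasDerivAt
      (fun y => Real.exp (κ * ∫ z in (0 : ℝ)..y, extendI f z))
      (extendI (κ • (coleHopf κ (toL2 f) * f)) y) y := by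
    intro y hy
    rw [uIcc_of_le x.2.1] at hy
    have hy' : y ∈ Icc (0 : ℝ) 1 := ⟨hy.1, hy.2.trans x.2.2⟩
    have := (((continuous_extendI f).integral_hasStrictDerivAt 0 y).hasDerivAt.const_mul κ).exp
    convert this using 1
    rw [extendI_of_mem _ hy', extendI_of_mem _ hy', ContinuousMap.smul_apply,
      ContinuousMap.mul_apply, coleHopf_apply, primitive_toL2]
    simp only [smul_eq_mul]
    ring
  rw [intervalIntegral.integral_eq_sub_of_hasDerivAt hd
    ((continuous_extendI _).intervalIntegrable _ _)]
  simp

/-! ### Cosines and sines in `L²(0,1)` -/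

lemma inner_toL2 (f : C(unitInterval, ℝ)) (g : L2Unit) :
    inner ℝ (toL2 f) g = ∫ x in Ioo (0 : ℝ) 1, extendI f x * g x := by
  rw [L2.inner_def]
  refine integral_congr_ae ?_
  filter_upwards [coeFn_toL2 f] with x hx
  simp [hx, mul_comm]

lemma inner_toL2_toL2 (f g : C(unitInterval, ℝ)) :
    inner ℝ (toL2 f) (toL2 g) = ∫ x in (0 : ℝ)..1, extendI f x * extendI g x := by
  rw [inner_toL2, intervalIntegral.integral_of_le zero_le_one, integral_Ioc_eq_integral_Ioo]
  refine integral_congr_ae ?_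
  filter_upwards [coeFn_toL2 g] with x hx
  rw [hx]

lemma inner_toL2_mulL2 (f h : C(unitInterval, ℝ)) (g : L2Unit) :
    inner ℝ (toL2 f) (mulL2 h g) = inner ℝ (toL2 (h * f)) g := by
  rw [inner_toL2, inner_toL2]
  refine integral_congr_ae ?_
  filter_upwards [coeFn_mulL2 h g] with x hx
  rw [hx]
  simp only [extendI, ContinuousMap.mul_apply]
  ring

/-- The function `x ↦ cos(nπx)` on `[0,1]`. -/
noncomputable def cosFun (n : ℕ) : C(unitInterval, ℝ) :=
  ⟨fun x => Real.cos (n * Real.pi * x), by fun_prop⟩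

/-- The function `x ↦ sin((n+1)πx)` on `[0,1]`. -/
noncomputable def sinFun (n : ℕ) : C(unitInterval, ℝ) :=
  ⟨fun x => Real.sin ((n + 1) * Real.pi * x), by fun_prop⟩

lemma cosFun_one_mul_succ (n : ℕ) :
    cosFun 1 * cosFun (n + 1) = (1 / 2 : ℝ) • (cosFun (n + 2) + cosFun n) := by
  ext x
  simp only [cosFun, ContinuousMap.mul_apply, ContinuousMap.coe_mk, ContinuousMap.smul_apply,
    ContinuousMap.add_apply, smul_eq_mul]
  rw [Real.cos_add_cos]
  push_cast
  ring_nf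

lemma cosFun_one_mul_mem_span {f : C(unitInterval, ℝ)}
    (hf : f ∈ Submodule.span ℝ (range cosFun)) :
    cosFun 1 * f ∈ Submodule.span ℝ (range cosFun) := by
  induction hf using Submodule.span_induction with
  | mem f hf =>
    obtain ⟨n, rfl⟩ := hf
    cases n with
    | zero =>
      have : cosFun 1 * cosFun 0 = cosFun 1 := by ext x; simp [cosFun]
      rw [this]
      exact Submodule.subset_span ⟨1, rfl⟩
    | succ n =>
      rw [cosFun_one_mul_succ]
      exact Submodule.smul_mem _ _ (Submodule.add_mem _ (Submodule.subset_span ⟨_, rfl⟩)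
        (Submodule.subset_span ⟨_, rfl⟩))
  | zero => simp
  | add f g _ _ hf hg => rw [mul_add]; exact Submodule.add_mem _ hf hg
  | smul c f _ hf => rw [mul_smul_comm]; exact Submodule.smul_mem _ _ hf

lemma cosFun_one_pow_mem_span (k : ℕ) :
    cosFun 1 ^ k ∈ Submodule.span ℝ (range cosFun) := by
  induction k with
  | zero =>
    have : (cosFun 1) ^ 0 = cosFun 0 := by ext x; simp [cosFun]
    rw [this]
    exact Submodule.subset_span ⟨0, rfl⟩
  | succ k ih => rw [pow_succ']; exact cosFun_one_mul_mem_span ih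

/-- Stone–Weierstrass for the algebra generated by `cos (πx)`, which separates points because cosine
is injective on `[0, π]`. The product formula keeps every power of `cos (πx)` in the linear span of
the cosines. -/
lemma dense_span_cosFun :
    Dense (Submodule.span ℝ (range cosFun) : Set C(unitInterval, ℝ)) := by
  have hsep : (Algebra.adjoin ℝ {cosFun 1}).SeparatesPoints := by
    intro x y hxy
    refine ⟨cosFun 1, ⟨cosFun 1, Algebra.subset_adjoin rfl, rfl⟩, fun h => hxy ?_⟩
    have h' : Real.cos (Real.pi * x) = Real.cos (Real.pi * y) := by simpa [cosFun] using h
    have hm : ∀ z : unitInterval, Real.pi * z ∈ Icc 0 Real.pi := fun z =>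
      ⟨mul_nonneg Real.pi_pos.le z.2.1, mul_le_of_le_one_right Real.pi_pos.le z.2.2⟩
    exact Subtype.ext (mul_left_cancel₀ Real.pi_ne_zero (Real.injOn_cos (hm x) (hm y) h'))
  have htop := ContinuousMap.subalgebra_topologicalClosure_eq_top_of_separatesPoints _ hsep
  have hd : Dense (Algebra.adjoin ℝ {cosFun 1} : Set C(unitInterval, ℝ)) := by
    rw [dense_iff_closure_eq, ← Subalgebra.topologicalClosure_coe, htop]
    rfl
  refine hd.mono fun f hf => ?_
  rw [SetLike.mem_coe, Algebra.adjoin_singleton_eq_range_aeval] at hf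
  obtain ⟨p, rfl⟩ := hf
  change (Polynomial.aeval (cosFun 1)) p ∈ Submodule.span ℝ (range cosFun)
  rw [Polynomial.aeval_eq_sum_range]
  exact Submodule.sum_mem _ fun k _ => Submodule.smul_mem _ _ (cosFun_one_pow_mem_span k)

lemma eq_zero_of_forall_inner_cosFun {g : L2Unit}
    (hg : ∀ n, inner ℝ (toL2 (cosFun n)) g = 0) : g = 0 := by
  have h₁ : ∀ f ∈ Submodule.span ℝ (range cosFun), inner ℝ (toL2 f) g = 0 := by
    intro f hf
    induction hf using Submodule.span_induction with
    | mem f hf => obtain ⟨n, rfl⟩ := hf; exact hg n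
    | zero => simp
    | add f f' _ _ hf hf' => rw [map_add, inner_add_left, hf, hf', add_zero]
    | smul c f _ hf => rw [map_smul, inner_smul_left, hf, mul_zero]
  have h₂ : ∀ f, inner ℝ (toL2 f) g = 0 := fun f =>
    congrFun (Continuous.ext_on dense_span_cosFun
      (toL2.continuous.inner continuous_const) continuous_const h₁) f
  have h₃ : ∀ f : L2Unit, inner ℝ f g = 0 := fun f =>
    congrFun (denseRange_toL2.equalizer (continuous_id.inner continuous_const)
      continuous_const (funext h₂)) f
  exact inner_self_eq_zero.1 (h₃ g)

lemma cosCoeff_eq_inner (n : ℕ) (f : C(unitInterval, ℝ)) :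
    cosCoeff n f = inner ℝ (toL2 (cosFun n)) (toL2 f) := by
  rw [cosCoeff_apply, inner_toL2_toL2]
  refine intervalIntegral.integral_congr fun x hx => ?_
  rw [uIcc_of_le zero_le_one] at hx
  simp only [extendI_of_mem _ hx]
  exact mul_comm _ _

lemma toL2_injective : Function.Injective toL2 := by
  rw [injective_iff_map_eq_zero]
  intro f hf
  have h₁ : extendI f =ᵐ[volume.restrict (Ioo (0 : ℝ) 1)] fun _ => 0 := by
    have h₀ : (toL2 f : ℝ → ℝ) =ᵐ[volume.restrict (Ioo (0 : ℝ) 1)] 0 := by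
      rw [hf]; exact Lp.coeFn_zero _ _ _
    exact (coeFn_toL2 f).symm.trans h₀
  have h₂ : EqOn (extendI f) (fun _ => 0) (Ioo (0 : ℝ) 1) :=
    Measure.eqOn_open_of_ae_eq h₁ isOpen_Ioo (continuous_extendI f).continuousOn
      continuousOn_const
  have h₃ : EqOn (extendI f) (fun _ => 0) (Icc (0 : ℝ) 1) := by
    have := h₂.closure (continuous_extendI f) continuous_const
    rwa [closure_Ioo zero_ne_one] at this
  ext x
  have := h₃ x.2
  rwa [extendI_of_mem _ x.2] at this

lemma eq_of_forall_cosCoeff_eq {f g : C(unitInterval, ℝ)} (h : ∀ n, cosCoeff n f = cosCoeff n g) :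
    f = g := by
  rw [← sub_eq_zero]
  apply toL2_injective
  rw [map_zero]
  refine eq_zero_of_forall_inner_cosFun fun n => ?_
  rw [← cosCoeff_eq_inner, map_sub, h n, sub_self]

lemma integral_cos_int_mul_pi (k : ℤ) :
    ∫ x in (0 : ℝ)..1, Real.cos (k * Real.pi * x) = if k = 0 then 1 else 0 := by
  split_ifs with h
  · simp [h]
  · have hk : (k : ℝ) * Real.pi ≠ 0 := mul_ne_zero (by exact_mod_cast h) Real.pi_ne_zero
    rw [intervalIntegral.integral_comp_mul_left _ hk]
    simp [Real.sin_int_mul_pi]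

/-- The normalised sines `√2 sin((n+1)πx)` in `L²(0,1)`. -/
noncomputable def sineVec (n : ℕ) : L2Unit := toL2 (√2 • sinFun n)

/-- The product of two sines is a difference of cosines with integer frequencies `m - n` and `m + n
+ 2`; only the frequency zero has a nonzero integral, and the second is never zero. -/
lemma orthonormal_sineVec : Orthonormal ℝ sineVec := by
  rw [orthonormal_iff_ite]
  intro m n
  rw [sineVec, sineVec, inner_toL2_toL2]
  have h : ∀ x ∈ uIcc (0 : ℝ) 1, extendI (√2 • sinFun m) x * extendI (√2 • sinFun n) x =
      Real.cos (((m : ℤ) - n : ℤ) * Real.pi * x) - Real.cos (((m : ℤ) + n + 2 : ℤ) * Real.pi * x) := by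
    intro x hx
    rw [uIcc_of_le zero_le_one] at hx
    rw [extendI_of_mem _ hx, extendI_of_mem _ hx, Real.cos_sub_cos]
    simp only [ContinuousMap.smul_apply, sinFun, ContinuousMap.coe_mk, smul_eq_mul]
    have h2 : √2 * √2 = 2 := Real.mul_self_sqrt zero_le_two
    push_cast
    have e₁ : ((m - n : ℝ) * Real.pi * x + (m + n + 2) * Real.pi * x) / 2
      = (m + 1) * Real.pi * x := by ring
    have e₂ : ((m - n : ℝ) * Real.pi * x - (m + n + 2) * Real.pi * x) / 2
      = -((n + 1) * Real.pi * x) := by ring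
    rw [e₁, e₂, Real.sin_neg]
    linear_combination (Real.sin ((m + 1) * Real.pi * x) * Real.sin ((n + 1) * Real.pi * x)) * h2
  rw [intervalIntegral.integral_congr h, intervalIntegral.integral_sub
    (Continuous.intervalIntegrable (by fun_prop) _ _)
    (Continuous.intervalIntegrable (by fun_prop) _ _), integral_cos_int_mul_pi,
    integral_cos_int_mul_pi, if_neg (by omega : ¬ ((m : ℤ) + n + 2 = 0)), sub_zero]
  simp only [sub_eq_zero, Nat.cast_inj]

/-- Completeness of the sines is reduced to that of the cosines: `sin (πx) cos (nπx)` is a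
combination of sines, so if `g` is orthogonal to all sines, then `sin (πx) g` is orthogonal to all
cosines and vanishes. Finally `sin (πx) > 0` on `(0, 1)`. -/
lemma span_sineVec_orthogonal : (Submodule.span ℝ (range sineVec))ᗮ = ⊥ := by
  rw [Submodule.eq_bot_iff]
  intro g hg
  have h₀ : ∀ n, inner ℝ (toL2 (sinFun n)) g = 0 := by
    intro n
    have h := (Submodule.mem_orthogonal _ _).1 hg _ (Submodule.subset_span ⟨n, rfl⟩)
    rw [sineVec, map_smul, inner_smul_left] at h
    exact (mul_eq_zero.1 h).resolve_left (by simp)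
  have h₁ : mulL2 (sinFun 0) g = 0 := by
    refine eq_zero_of_forall_inner_cosFun fun n => ?_
    rw [inner_toL2_mulL2]
    match n with
    | 0 =>
      have : sinFun 0 * cosFun 0 = sinFun 0 := by ext x; simp [cosFun]
      rw [this, h₀]
    | 1 =>
      have : sinFun 0 * cosFun 1 = (1 / 2 : ℝ) • sinFun 1 := by
        ext x
        simp only [cosFun, sinFun, ContinuousMap.mul_apply, ContinuousMap.coe_mk,
          ContinuousMap.smul_apply, smul_eq_mul]
        have e : ((1 : ℕ) + 1 : ℝ) * Real.pi * x = 2 * (Real.pi * x) := by push_cast; ring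
        rw [e, Real.sin_two_mul]
        simp [← mul_assoc]
      rw [this, map_smul, inner_smul_left, h₀, mul_zero]
    | n + 2 =>
      have : sinFun 0 * cosFun (n + 2) = (1 / 2 : ℝ) • (sinFun (n + 2) - sinFun n) := by
        ext x
        simp only [cosFun, sinFun, ContinuousMap.mul_apply, ContinuousMap.coe_mk,
          ContinuousMap.smul_apply, smul_eq_mul, ContinuousMap.sub_apply]
        rw [Real.sin_sub_sin]
        push_cast
        ring_nf
      rw [this, map_smul, map_sub, inner_smul_left, inner_sub_left, h₀, h₀, sub_zero, mul_zero]
  have h₂ : (mulL2 (sinFun 0) g : ℝ → ℝ) =ᵐ[volume.restrict (Ioo (0 : ℝ) 1)] 0 := by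
    rw [h₁]; exact Lp.coeFn_zero _ _ _
  refine Lp.ext ?_
  filter_upwards [h₂, coeFn_mulL2 (sinFun 0) g, ae_restrict_mem measurableSet_Ioo,
    Lp.coeFn_zero ℝ 2 (volume.restrict (Ioo (0 : ℝ) 1))] with x h₃ h₄ hx h₅
  rw [h₅, Pi.zero_apply]
  rw [h₃, extendI_of_mem _ (Ioo_subset_Icc_self hx)] at h₄
  refine (mul_eq_zero.1 h₄.symm).resolve_left (ne_of_gt ?_)
  simp only [sinFun, ContinuousMap.coe_mk, Nat.cast_zero, zero_add, one_mul]
  exact Real.sin_pos_of_pos_of_lt_pi (mul_pos Real.pi_pos hx.1)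
    (mul_lt_of_lt_one_right Real.pi_pos hx.2)

/-- The Hilbert basis of `L²(0,1)` made of the normalised sines. -/
noncomputable def sineBasis : HilbertBasis ℕ ℝ L2Unit :=
  HilbertBasis.mkOfOrthogonalEqBot orthonormal_sineVec span_sineVec_orthogonal

lemma sineBasis_apply (n : ℕ) : sineBasis n = sineVec n :=
  congrFun (HilbertBasis.coe_mkOfOrthogonalEqBot _ _) n

/-! ### The Dirichlet heat semigroup -/

/-- The factor by which the Dirichlet heat semigroup multiplies the `n`-th sine. -/
noncomputable def heatFactor (ν : ℝ) (n : ℕ) (t : ℝ) : ℝ :=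
  Real.exp (-(ν * ((n + 1) * Real.pi) ^ 2) * t)

lemma heatFactor_le_one {ν : ℝ} (hν : 0 < ν) (n : ℕ) {t : ℝ} (ht : 0 ≤ t) :
    heatFactor ν n t ≤ 1 := by
  rw [heatFactor, Real.exp_le_one_iff, neg_mul, neg_nonpos]
  positivity

lemma heatFactor_pos (ν : ℝ) (n : ℕ) (t : ℝ) : 0 < heatFactor ν n t := Real.exp_pos _

lemma memℓp_heatFactor {ν : ℝ} (hν : 0 < ν) (t : ℝ) (a : lp (fun _ : ℕ => ℝ) 2) :
    Memℓp (fun n => heatFactor ν n |t| * a n) 2 := by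
  refine memℓp_gen (Summable.of_nonneg_of_le (fun n => by positivity) (fun n => ?_)
    ((lp.memℓp a).summable (by norm_num)))
  refine Real.rpow_le_rpow (norm_nonneg _) ?_ (by norm_num)
  rw [norm_mul, Real.norm_of_nonneg (heatFactor_pos _ _ _).le]
  exact mul_le_of_le_one_left (norm_nonneg _) (heatFactor_le_one hν n (abs_nonneg t))

/-- The Dirichlet heat semigroup on `L²(0,1)` at time `|t|`. -/
noncomputable def sineHeat {ν : ℝ} (hν : 0 < ν) (t : ℝ) (g : L2Unit) : L2Unit :=
  sineBasis.repr.symm ⟨_, memℓp_heatFactor hν t (sineBasis.repr g)⟩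

lemma hasSum_sineHeat {ν : ℝ} (hν : 0 < ν) {t : ℝ} (ht : 0 ≤ t) (g : L2Unit) :
    HasSum (fun n => (heatFactor ν n t * inner ℝ (sineVec n) g) • sineVec n) (sineHeat hν t g) := by
  have h := sineBasis.hasSum_repr_symm ⟨_, memℓp_heatFactor hν t (sineBasis.repr g)⟩
  rw [sineHeat]
  simp only [sineBasis_apply, HilbertBasis.repr_apply_apply, abs_of_nonneg ht] at h ⊢
  exact h

lemma sineHeat_zero {ν : ℝ} (hν : 0 < ν) (g : L2Unit) : sineHeat hν 0 g = g := by
  have h := hasSum_sineHeat hν le_rfl g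
  have h' := sineBasis.hasSum_repr g
  simp only [sineBasis_apply, HilbertBasis.repr_apply_apply] at h'
  simp only [heatFactor, mul_zero, Real.exp_zero, one_mul] at h
  exact h.unique h'

lemma norm_sq_lp_two (a : lp (fun _ : ℕ => ℝ) 2) : ‖a‖ ^ 2 = ∑' n, a n ^ 2 := by
  have h := lp.norm_rpow_eq_tsum (p := 2) (by norm_num) a
  simpa using h

lemma summable_sq_lp_two (a : lp (fun _ : ℕ => ℝ) 2) : Summable fun n => a n ^ 2 := by
  have h := (lp.memℓp a).summable (by norm_num)
  simpa using h

/-- Joint continuity follows from continuity in time for fixed `g` (dominated convergence on the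
coefficients) and from the contraction property in `g`, uniform in time. -/
lemma continuous_sineHeat {ν : ℝ} (hν : 0 < ν) :
    Continuous fun p : L2Unit × ℝ => sineHeat hν p.2 p.1 := by
  refine continuous_prod_of_continuous_lipschitzWith _ 1 (fun g => ?_) (fun t => ?_)
  · refine sineBasis.repr.symm.continuous.comp ?_
    rw [continuous_iff_continuousAt]
    intro s
    rw [ContinuousAt, tendsto_iff_norm_sub_tendsto_zero]
    set a := sineBasis.repr g
    have key : Filter.Tendsto (fun t => ∑' n, (heatFactor ν n |t| * a n - heatFactor ν n |s| * a n) ^ 2)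
        (nhds s) (nhds (∑' n : ℕ, (0 : ℝ))) := by
      refine tendsto_tsum_of_dominated_convergence (bound := fun n => a n ^ 2)
        (summable_sq_lp_two a) (fun n => ?_) (Filter.Eventually.of_forall fun t n => ?_)
      · have : Continuous fun t => (heatFactor ν n |t| * a n - heatFactor ν n |s| * a n) ^ 2 := by
          unfold heatFactor; fun_prop
        simpa using this.tendsto s
      · rw [← sub_mul, mul_pow, Real.norm_of_nonneg (by positivity)]
        refine mul_le_of_le_one_left (sq_nonneg _) ?_
        rw [sq_le_one_iff_abs_le_one, abs_le]
        have h₁ := heatFactor_le_one hν n (abs_nonneg t)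
        have h₂ := heatFactor_le_one hν n (abs_nonneg s)
        have h₃ := heatFactor_pos ν n |t|
        have h₄ := heatFactor_pos ν n |s|
        constructor <;> linarith
    rw [tsum_zero] at key
    have h₂ := (Real.continuous_sqrt.tendsto 0).comp key
    rw [Real.sqrt_zero] at h₂
    refine h₂.congr fun t => ?_
    rw [Function.comp_apply, ← Real.sqrt_sq (norm_nonneg (_ - _)), norm_sq_lp_two]
    rfl
  · refine LipschitzWith.of_dist_le_mul fun g h => ?_
    rw [NNReal.coe_one, one_mul, dist_eq_norm, dist_eq_norm]
    simp only [sineHeat]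
    rw [← map_sub, LinearIsometryEquiv.norm_map, ← sineBasis.repr.norm_map (g - h)]
    refine lp.norm_mono (by norm_num) fun n => ?_
    rw [map_sub]
    change ‖heatFactor ν n |t| * sineBasis.repr g n - heatFactor ν n |t| * sineBasis.repr h n‖
      ≤ ‖sineBasis.repr g n - sineBasis.repr h n‖
    rw [← mul_sub, norm_mul, Real.norm_of_nonneg (heatFactor_pos _ _ _).le]
    exact mul_le_of_le_one_left (norm_nonneg _) (heatFactor_le_one hν n (abs_nonneg t))

/-! ### Trigonometric series solving the heat equation -/

/-- At most polynomial growth of a sequence. -/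
def PolyGrowth (b : ℕ → ℝ) : Prop := ∃ (C : ℝ) (k : ℕ), ∀ n, |b n| ≤ C * ((n : ℝ) + 1) ^ k

/-- The coefficients of the derivative of a trigonometric series with frequencies `(n+1)π`. -/
noncomputable def derivCoeff (b : ℕ → ℝ) (n : ℕ) : ℝ := b n * ((n + 1) * Real.pi)

lemma PolyGrowth.derivCoeff {b : ℕ → ℝ} (hb : PolyGrowth b) : PolyGrowth (derivCoeff b) := by
  obtain ⟨C, k, h⟩ := hb
  refine ⟨C * Real.pi, k + 1, fun n => ?_⟩
  have hn : (0 : ℝ) ≤ (n + 1) * Real.pi := by positivity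
  rw [_root_.derivCoeff, abs_mul, abs_of_nonneg hn]
  calc |b n| * ((n + 1) * Real.pi) ≤ (C * ((n : ℝ) + 1) ^ k) * ((n + 1) * Real.pi) :=
        mul_le_mul_of_nonneg_right (h n) hn
    _ = _ := by ring

lemma heatFactor_anti {ν : ℝ} (hν : 0 < ν) (n : ℕ) {s t : ℝ} (hst : s ≤ t) :
    heatFactor ν n t ≤ heatFactor ν n s := by
  rw [heatFactor, heatFactor, Real.exp_le_exp]
  have : 0 ≤ ν * ((n + 1) * Real.pi) ^ 2 := by positivity
  nlinarith

lemma summable_pow_mul_heatFactor {ν : ℝ} (hν : 0 < ν) {t : ℝ} (ht : 0 < t) (C : ℝ) (k : ℕ) :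
    Summable fun n : ℕ => C * ((n : ℝ) + 1) ^ k * heatFactor ν n t := by
  have hr : 0 < ν * Real.pi ^ 2 * t := by positivity
  have h := (summable_nat_add_iff 1).2 (Real.summable_pow_mul_exp_neg_nat_mul k hr)
  simp only [mul_assoc C]
  refine Summable.mul_left C (Summable.of_nonneg_of_le (fun n => ?_) (fun n => ?_) h)
  · exact mul_nonneg (by positivity) (heatFactor_pos _ _ _).le
  · push_cast
    refine mul_le_mul_of_nonneg_left ?_ (by positivity)
    rw [heatFactor, Real.exp_le_exp]
    have h1 : (1 : ℝ) ≤ n + 1 := by linarith [n.cast_nonneg (α := ℝ)]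
    have h2 : (n + 1 : ℝ) ≤ (n + 1) ^ 2 := by nlinarith
    have := mul_le_mul_of_nonneg_left h2 hr.le
    nlinarith

lemma summable_abs_mul_heatFactor {ν : ℝ} (hν : 0 < ν) {b : ℕ → ℝ} (hb : PolyGrowth b) {t : ℝ}
    (ht : 0 < t) : Summable fun n => |b n| * heatFactor ν n t := by
  obtain ⟨C, k, h⟩ := hb
  refine Summable.of_nonneg_of_le (fun n => mul_nonneg (abs_nonneg _) (heatFactor_pos _ _ _).le)
    (fun n => ?_) (summable_pow_mul_heatFactor hν ht C k)
  exact mul_le_mul_of_nonneg_right (h n) (heatFactor_pos _ _ _).le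

/-- The trigonometric series `∑ bₙ exp(-ν((n+1)π)²t) cos((n+1)πx + θ)`. -/
noncomputable def heatSeries (ν : ℝ) (b : ℕ → ℝ) (θ t x : ℝ) : ℝ :=
  ∑' n, b n * heatFactor ν n t * Real.cos ((n + 1) * Real.pi * x + θ)

lemma norm_heatSeries_term_le {ν : ℝ} (hν : 0 < ν) (b : ℕ → ℝ) (θ x : ℝ) {s t : ℝ} (hst : s ≤ t)
    (n : ℕ) : ‖b n * heatFactor ν n t * Real.cos ((n + 1) * Real.pi * x + θ)‖
      ≤ |b n| * heatFactor ν n s := by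
  rw [norm_mul, norm_mul, Real.norm_of_nonneg (heatFactor_pos _ _ _).le]
  calc _ ≤ ‖b n‖ * heatFactor ν n t * 1 :=
        mul_le_mul_of_nonneg_left (Real.abs_cos_le_one _)
          (mul_nonneg (norm_nonneg _) (heatFactor_pos _ _ _).le)
    _ ≤ _ := by
        rw [mul_one]
        exact mul_le_mul_of_nonneg_left (heatFactor_anti hν n hst) (norm_nonneg _)

lemma summable_heatSeries {ν : ℝ} (hν : 0 < ν) {b : ℕ → ℝ} (hb : PolyGrowth b) (θ x : ℝ) {t : ℝ}
    (ht : 0 < t) :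
    Summable fun n => b n * heatFactor ν n t * Real.cos ((n + 1) * Real.pi * x + θ) :=
  Summable.of_norm_bounded (summable_abs_mul_heatFactor hν hb ht)
    (norm_heatSeries_term_le hν b θ x le_rfl)

/-- The phase `θ` keeps derivatives in the same family: differentiating in `x` shifts it by `π/2`
and multiplies the coefficients by the frequencies, which preserves polynomial growth. -/
lemma hasDerivAt_heatSeries_x {ν : ℝ} (hν : 0 < ν) {b : ℕ → ℝ} (hb : PolyGrowth b) (θ x : ℝ)
    {t : ℝ} (ht : 0 < t) :
    HasDerivAt (heatSeries ν b θ t) (heatSeries ν (derivCoeff b) (θ + Real.pi / 2) t x) x := by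
  refine hasDerivAt_tsum (summable_abs_mul_heatFactor hν hb.derivCoeff ht)
    (g := fun n x => b n * heatFactor ν n t * Real.cos ((n + 1) * Real.pi * x + θ))
    (fun n y => ?_) (fun n y => norm_heatSeries_term_le hν _ _ y le_rfl n)
    (summable_heatSeries hν hb θ 0 ht) x
  have h : HasDerivAt (fun y : ℝ => ((n : ℝ) + 1) * Real.pi * y + θ) ((n + 1) * Real.pi * 1) y :=
    ((hasDerivAt_id y).const_mul _).add_const _
  refine ((h.cos).const_mul (b n * heatFactor ν n t)).congr_deriv ?_
  rw [← add_assoc, Real.cos_add_pi_div_two, derivCoeff]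
  ring

lemma hasDerivAt_heatSeries_t {ν : ℝ} (hν : 0 < ν) {b : ℕ → ℝ} (hb : PolyGrowth b) (θ x : ℝ)
    {t : ℝ} (ht : 0 < t) :
    HasDerivAt (fun s => heatSeries ν b θ s x)
      (ν * heatSeries ν (derivCoeff (derivCoeff b)) (θ + Real.pi / 2 + Real.pi / 2) t x) t := by
  rw [heatSeries, ← tsum_mul_left]
  -- The heat factors decrease in time, so their values at `t / 2` dominate the differentiated
  -- series on the neighbourhood `(t / 2, ∞)` of `t`.
  have hs : Summable fun n => ν * (|derivCoeff (derivCoeff b) n| * heatFactor ν n (t / 2)) :=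
    (summable_abs_mul_heatFactor hν hb.derivCoeff.derivCoeff (half_pos ht)).mul_left ν
  refine hasDerivAt_tsum_of_isPreconnected hs (isOpen_Ioi (a := t / 2)) isPreconnected_Ioi
    (g := fun n s => b n * heatFactor ν n s * Real.cos ((n + 1) * Real.pi * x + θ))
    (g' := fun n s => ν * (derivCoeff (derivCoeff b) n * heatFactor ν n s *
      Real.cos ((n + 1) * Real.pi * x + (θ + Real.pi / 2 + Real.pi / 2))))
    (fun n s _ => ?_) (fun n s hs => ?_) (y₀ := t) (mem_Ioi.2 (by linarith))
    (summable_heatSeries hν hb θ x ht) (mem_Ioi.2 (by linarith))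
  · have h : HasDerivAt (heatFactor ν n)
        (Real.exp (-(ν * ((n + 1) * Real.pi) ^ 2) * s) * (-(ν * ((n + 1) * Real.pi) ^ 2) * 1)) s :=
      ((hasDerivAt_id s).const_mul _).exp
    refine ((h.const_mul (b n)).mul_const (Real.cos ((n + 1) * Real.pi * x + θ))).congr_deriv ?_
    rw [add_assoc θ, add_halves, ← add_assoc, Real.cos_add_pi, derivCoeff, derivCoeff, heatFactor]
    ring
  · rw [norm_mul, Real.norm_of_nonneg hν.le]
    exact mul_le_mul_of_nonneg_left (norm_heatSeries_term_le hν _ _ x (le_of_lt hs) n) hν.le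

lemma continuousOn_heatSeries {ν : ℝ} (hν : 0 < ν) {b : ℕ → ℝ} (hb : PolyGrowth b) (θ : ℝ) :
    ContinuousOn (fun p : ℝ × ℝ => heatSeries ν b θ p.1 p.2) {p | 0 < p.1} := by
  intro p hp
  have hp' : 0 < p.1 := hp
  have h : ContinuousOn (fun p : ℝ × ℝ => heatSeries ν b θ p.1 p.2) {q | p.1 / 2 < q.1} := by
    refine continuousOn_tsum (fun n => ?_) (summable_abs_mul_heatFactor hν hb (half_pos hp'))
      (fun n q hq => norm_heatSeries_term_le hν b θ q.2 (le_of_lt hq) n)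
    unfold heatFactor
    fun_prop
  have ho : IsOpen {q : ℝ × ℝ | p.1 / 2 < q.1} := isOpen_lt continuous_const continuous_fst
  exact (h.continuousAt (ho.mem_nhds (by simp only [mem_ofPred_eq]; linarith))).continuousWithinAt

lemma heatSeries_add_two (ν : ℝ) (b : ℕ → ℝ) (θ t x : ℝ) :
    heatSeries ν b θ t (x + 2) = heatSeries ν b θ t x := by
  refine tsum_congr fun n => ?_
  have : ((n : ℝ) + 1) * Real.pi * (x + 2) + θ
      = ((n : ℝ) + 1) * Real.pi * x + θ + ((n + 1 : ℕ) : ℝ) * (2 * Real.pi) := by push_cast; ring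
  rw [this, Real.cos_add_nat_mul_two_pi]

lemma heatSeries_neg_zero (ν : ℝ) (b : ℕ → ℝ) (t x : ℝ) :
    heatSeries ν b 0 t (-x) = heatSeries ν b 0 t x := by
  refine tsum_congr fun n => ?_
  rw [add_zero, add_zero, mul_neg, Real.cos_neg]

/-- With phase `π/2` the series is a sine series. This is the Neumann condition for `φ`, hence the
Dirichlet condition for `u`. -/
lemma heatSeries_pi_div_two_eq_zero (ν : ℝ) (b : ℕ → ℝ) (t : ℝ) (m : ℕ) :
    heatSeries ν b (Real.pi / 2) t m = 0 := by
  refine (tsum_congr fun n => ?_).trans tsum_zero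
  have : ((n : ℝ) + 1) * Real.pi * m = (((n + 1) * m : ℕ) : ℝ) * Real.pi := by push_cast; ring
  rw [Real.cos_add_pi_div_two, this, Real.sin_nat_mul_pi, neg_zero, mul_zero]

/-! ### The minimum principle on the circle -/

/-- Were `f''` negative, the minimum point would also be a local maximum; `f` would be locally
constant there, forcing `f'' = 0`. -/
lemma nonneg_deriv2_of_isMinOn {f f' : ℝ → ℝ} {f'' x : ℝ} (hf : ∀ y, HasDerivAt f (f' y) y)
    (hf' : HasDerivAt f' f'' x) (hmin : ∀ y, f x ≤ f y) : 0 ≤ f'' := by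
  have hd : deriv f = f' := funext fun y => (hf y).deriv
  have h0 : f' x = 0 :=
    IsLocalMin.hasDerivAt_eq_zero (Filter.Eventually.of_forall hmin) (hf x)
  by_contra! hneg
  have hmax := isLocalMax_of_deriv_deriv_neg (f := f) (x₀ := x)
    (by rw [hd, hf'.deriv]; exact hneg) (by rw [hd, h0]) (hf x).continuousAt
  have hc : f =ᶠ[nhds x] fun _ => f x := by
    filter_upwards [hmax] with y hy
    exact le_antisymm hy (hmin y)
  have h1 : f' =ᶠ[nhds x] fun _ => 0 := by
    have := hc.deriv
    rw [hd] at this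
    simpa using this
  have h2 := (h1.hasDerivAt_iff).1 hf'
  have := h2.unique (hasDerivAt_const x (0 : ℝ))
  linarith

/-- Periodicity leaves no lateral boundary. At a minimum of `f + ηt` reached after time `δ`, the
second space derivative is nonnegative while the left time derivative is nonpositive, which
contradicts `∂ₜ(f + ηt) = ν fxx + η`. So the minimum is at time `δ`, and `η` is then made small. -/
lemma heat_min_principle {ν δ m : ℝ} {f fx fxx : ℝ → ℝ → ℝ} (hδ : 0 < δ)
    (hc : ContinuousOn (fun p : ℝ × ℝ => f p.1 p.2) {p | 0 < p.1})
    (hx : ∀ t, 0 < t → ∀ x, HasDerivAt (f t) (fx t x) x)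
    (hxx : ∀ t, 0 < t → ∀ x, HasDerivAt (fx t) (fxx t x) x)
    (ht : ∀ t, 0 < t → ∀ x, HasDerivAt (fun s => f s x) (ν * fxx t x) t)
    (hν : 0 < ν) (hper : ∀ t x, f t (x + 2) = f t x) (hm : ∀ x, m ≤ f δ x) {t : ℝ} (hδt : δ ≤ t)
    (x : ℝ) : m ≤ f t x := by
  have hper' : ∀ s y, ∃ z ∈ Icc (0 : ℝ) 2, f s z = f s y := by
    intro s y
    have hp : Function.Periodic (f s) 2 := hper s
    obtain ⟨z, hz, h⟩ := hp.exists_mem_Ico₀ zero_lt_two y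
    exact ⟨z, Ico_subset_Icc_self hz, h.symm⟩
  refine le_of_forall_pos_le_add fun ε hε => ?_
  obtain ⟨η, hη, hηε⟩ : ∃ η : ℝ, 0 < η ∧ η * (t - δ) ≤ ε := by
    -- The summand `1` covers the case `t = δ`.
    refine ⟨ε / (t - δ + 1), by have : 0 < t - δ + 1 := by linarith
                                positivity, ?_⟩
    rw [div_mul_eq_mul_div, div_le_iff₀ (by linarith)]
    nlinarith
  let g : ℝ × ℝ → ℝ := fun p => f p.1 p.2 + η * p.1
  have hgc : ContinuousOn g (Icc δ t ×ˢ Icc 0 2) := by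
    refine (hc.mono fun p hp => ?_).add (by fun_prop)
    exact lt_of_lt_of_le hδ hp.1.1
  obtain ⟨⟨s, y⟩, hsy, hmin⟩ := (isCompact_Icc.prod isCompact_Icc).exists_isMinOn
    ⟨(δ, 0), ⟨left_mem_Icc.2 hδt, by norm_num⟩⟩ hgc
  have hmin' : ∀ s' ∈ Icc δ t, ∀ y', f s y + η * s ≤ f s' y' + η * s' := by
    intro s' hs' y'
    obtain ⟨z, hz, h⟩ := hper' s' y'
    rw [← h]
    exact hmin (show (s', z) ∈ Icc δ t ×ˢ Icc (0 : ℝ) 2 from ⟨hs', hz⟩)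
  have hs0 : 0 < s := lt_of_lt_of_le hδ hsy.1.1
  rcases eq_or_lt_of_le hsy.1.1 with h | h
  · have h1 := hmin' t (right_mem_Icc.2 hδt) x
    have h2 := hm y
    simp only at h
    subst h
    nlinarith
  · exfalso
    have h2 : 0 ≤ fxx s y := by
      refine nonneg_deriv2_of_isMinOn (hx s hs0) (hxx s hs0 y) fun y' => ?_
      have := hmin' s hsy.1 y'
      linarith
    have hd : HasDerivAt (fun r => f r y + η * r) (ν * fxx s y + η * 1) s :=
      (ht s hs0 y).add ((hasDerivAt_id s).const_mul η)
    have hd' := hd.hasDerivWithinAt (s := Iio s)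
    have h3 : ν * fxx s y + η * 1 ≤ 0 := by
      rw [hasDerivWithinAt_iff_tendsto_slope' (by simp)] at hd'
      refine le_of_tendsto hd' ?_
      filter_upwards [Ioo_mem_nhdsLT h] with r hr
      rw [slope_def_field]
      refine div_nonpos_of_nonneg_of_nonpos ?_ (by linarith [hr.2])
      have := hmin' r ⟨hr.1.le, hr.2.le.trans hsy.1.2⟩ y
      linarith
    nlinarith [mul_nonneg hν.le h2]

/-! ### The Cole–Hopf formula yields classical solutions -/

lemma isClassicalNudgedBurgers_coleHopf {ν T : ℝ} {k obs φ φx φxx φxxx : ℝ → ℝ → ℝ}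
    (hk : ∀ t ∈ Ioo 0 T, ∀ x ∈ Ioo (0 : ℝ) 1, k t x = 0)
    (hpos : ∀ t, 0 < t → ∀ x, 0 < φ t x)
    (hc : ContinuousOn (fun p : ℝ × ℝ => φ p.1 p.2) {p | 0 < p.1})
    (hcx : ContinuousOn (fun p : ℝ × ℝ => φx p.1 p.2) {p | 0 < p.1})
    (hcxx : ContinuousOn (fun p : ℝ × ℝ => φxx p.1 p.2) {p | 0 < p.1})
    (hcxxx : ContinuousOn (fun p : ℝ × ℝ => φxxx p.1 p.2) {p | 0 < p.1})
    (hx : ∀ t, 0 < t → ∀ x, HasDerivAt (φ t) (φx t x) x)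
    (hxx : ∀ t, 0 < t → ∀ x, HasDerivAt (φx t) (φxx t x) x)
    (hxxx : ∀ t, 0 < t → ∀ x, HasDerivAt (φxx t) (φxxx t x) x)
    (ht : ∀ t, 0 < t → ∀ x, HasDerivAt (fun s => φ s x) (ν * φxx t x) t)
    (hxt : ∀ t, 0 < t → ∀ x, HasDerivAt (fun s => φx s x) (ν * φxxx t x) t)
    (h0 : ∀ t, φx t 0 = 0) (h1 : ∀ t, φx t 1 = 0) :
    IsClassicalNudgedBurgers ν T k obs (fun t x => -2 * ν * (φx t x / φ t x)) := by
  set w : ℝ → ℝ → ℝ := fun t x => -2 * ν * (φx t x / φ t x)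
  have hne : ∀ t, 0 < t → ∀ x, φ t x ≠ 0 := fun t h x => (hpos t h x).ne'
  have dt : ∀ t, 0 < t → ∀ x, HasDerivAt (fun s => w s x)
      (-2 * ν * ((ν * φxxx t x * φ t x - φx t x * (ν * φxx t x)) / φ t x ^ 2)) t := fun t h x =>
    ((hxt t h x).div (ht t h x) (hne t h x)).const_mul _
  have dx : ∀ t, 0 < t → ∀ x, HasDerivAt (w t)
      (-2 * ν * ((φxx t x * φ t x - φx t x * φx t x) / φ t x ^ 2)) x := fun t h x =>
    ((hxx t h x).div (hx t h x) (hne t h x)).const_mul _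
  have edx : ∀ t, 0 < t → deriv (w t) =
      fun x => -2 * ν * ((φxx t x * φ t x - φx t x * φx t x) / φ t x ^ 2) := fun t h =>
    funext fun x => (dx t h x).deriv
  have dxx : ∀ t, 0 < t → ∀ x, HasDerivAt (deriv (w t))
      (-2 * ν * (((φxxx t x * φ t x + φxx t x * φx t x - (φxx t x * φx t x + φx t x * φxx t x))
        * φ t x ^ 2 - (φxx t x * φ t x - φx t x * φx t x) * (2 * φ t x * φx t x))
        / (φ t x ^ 2) ^ 2)) x := by
    intro t h x
    rw [edx t h]
    have hsq : HasDerivAt (fun x => φ t x ^ 2) (2 * φ t x * φx t x) x := by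
      refine ((hx t h x).fun_pow 2).congr_deriv ?_
      simp
    exact (((((hxxx t h x).mul (hx t h x)).sub ((hxx t h x).mul (hxx t h x))).div hsq
      (pow_ne_zero 2 (hne t h x)))).const_mul _
  have hsub : Ioo 0 T ×ˢ Ioo (0 : ℝ) 1 ⊆ {p : ℝ × ℝ | 0 < p.1} := fun p hp => hp.1.1
  have hne' : ∀ p ∈ {p : ℝ × ℝ | 0 < p.1}, φ p.1 p.2 ≠ 0 := fun p hp => hne _ hp _
  refine ⟨?_, ?_, ?_, ?_, ?_, ?_, ?_, ?_, ?_, ?_⟩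
  · exact ((hcx.div hc hne').const_mul _).mono fun p hp => hp.1.1
  · intro t _; simp [w, h0]
  · intro t _; simp [w, h1]
  · exact fun t h x _ => (dt t h.1 x).differentiableAt
  · exact fun t h x _ => (dx t h.1 x).differentiableAt
  · exact fun t h x _ => (dxx t h.1 x).differentiableAt
  · refine ContinuousOn.congr (f := fun p : ℝ × ℝ => -2 * ν * ((ν * φxxx p.1 p.2 * φ p.1 p.2
      - φx p.1 p.2 * (ν * φxx p.1 p.2)) / φ p.1 p.2 ^ 2)) ?_ fun p hp => (dt _ hp.1.1 _).deriv
    refine ContinuousOn.mono ?_ hsub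
    exact ((((hcxxx.const_mul ν).mul hc).sub (hcx.mul (hcxx.const_mul ν))).div (hc.pow 2)
      fun p hp => pow_ne_zero 2 (hne' p hp)).const_mul _
  · refine ContinuousOn.congr (f := fun p : ℝ × ℝ => -2 * ν * ((φxx p.1 p.2 * φ p.1 p.2
      - φx p.1 p.2 * φx p.1 p.2) / φ p.1 p.2 ^ 2)) ?_ fun p hp => (dx _ hp.1.1 _).deriv
    refine ContinuousOn.mono ?_ hsub
    exact (((hcxx.mul hc).sub (hcx.mul hcx)).div (hc.pow 2)
      fun p hp => pow_ne_zero 2 (hne' p hp)).const_mul _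
  · refine ContinuousOn.congr ?_ fun p hp => (dxx _ hp.1.1 _).deriv
    refine ContinuousOn.mono ?_ hsub
    refine (((((hcxxx.mul hc).add (hcxx.mul hcx)).sub ((hcxx.mul hcx).add (hcx.mul hcxx))).mul
      (hc.pow 2)).sub (((hcxx.mul hc).sub (hcx.mul hcx)).mul ((hc.const_mul 2).mul hcx))).div
      ((hc.pow 2).pow 2) (fun p hp => pow_ne_zero 2 (pow_ne_zero 2 (hne' p hp))) |>.const_mul _
  · intro t h x hx'
    rw [(dt t h.1 x).deriv, (dxx t h.1 x).deriv, (dx t h.1 x).deriv, hk t h x hx']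
    have := hne t h.1 x
    simp only [w]
    field_simp
    ring

/-! ### Existence: the Cole–Hopf flow -/

/-- The primitive of zero mean of an element of `L²(0,1)`. -/
noncomputable def zeroMeanPrimitive : L2Unit →L[ℝ] C(unitInterval, ℝ) :=
  primitive - ((cosCoeff 0).comp primitive).smulRight 1

lemma zeroMeanPrimitive_apply (g : L2Unit) (x : unitInterval) :
    zeroMeanPrimitive g x = primitive g x - cosCoeff 0 (primitive g) := by
  simp [zeroMeanPrimitive]

lemma cosCoeff_zero_one : cosCoeff 0 1 = 1 := by
  rw [cosCoeff_apply]
  simp [extendI]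

/-- Normalising the mean to zero removes the constant of integration, so sines become pure cosines:
the primitive carries the Dirichlet flow of `∂ₓφ` to the Neumann flow of `φ` minus its mean. -/
lemma zeroMeanPrimitive_sineVec (n : ℕ) (x : unitInterval) :
    zeroMeanPrimitive (sineVec n) x
      = -(√2 / ((n + 1) * Real.pi)) * Real.cos ((n + 1) * Real.pi * x) := by
  have ha : ((n : ℝ) + 1) * Real.pi ≠ 0 := by positivity
  have hp : ∀ x : unitInterval, primitive (sineVec n) x
      = √2 / ((n + 1) * Real.pi) * (1 - Real.cos ((n + 1) * Real.pi * x)) := by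
    intro x
    rw [sineVec, primitive_toL2]
    have : ∀ y ∈ uIcc (0 : ℝ) x, extendI (√2 • sinFun n) y
        = √2 * Real.sin ((n + 1) * Real.pi * y) := by
      intro y hy
      rw [uIcc_of_le x.2.1] at hy
      rw [extendI_of_mem _ ⟨hy.1, hy.2.trans x.2.2⟩]
      rfl
    rw [intervalIntegral.integral_congr this, intervalIntegral.integral_const_mul,
      intervalIntegral.integral_comp_mul_left _ ha, integral_sin]
    simp only [mul_zero, Real.cos_zero, smul_eq_mul]
    ring
  have hm : cosCoeff 0 (primitive (sineVec n)) = √2 / ((n + 1) * Real.pi) := by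
    rw [cosCoeff_apply]
    have : ∀ y ∈ uIcc (0 : ℝ) 1, extendI (primitive (sineVec n)) y
        * Real.cos ((0 : ℕ) * Real.pi * y) = √2 / ((n + 1) * Real.pi) *
          (1 - Real.cos (((n + 1 : ℕ) : ℤ) * Real.pi * y)) := by
      intro y hy
      rw [uIcc_of_le zero_le_one] at hy
      rw [extendI_of_mem _ hy, hp]
      simp
    rw [intervalIntegral.integral_congr this, intervalIntegral.integral_const_mul,
      intervalIntegral.integral_sub (by simp) (Continuous.intervalIntegrable (by fun_prop) _ _),
      integral_cos_int_mul_pi, if_neg (by omega)]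
    simp
  rw [zeroMeanPrimitive_apply, hp, hm]
  ring

section Flow

variable {ν : ℝ} (hν : 0 < ν) (κ : ℝ)

/-- The derivative of the Cole–Hopf transform of `u₀`. -/
noncomputable def heatDatum (κ : ℝ) (u₀ : L2Unit) : L2Unit := κ • mulL2 (coleHopf κ u₀) u₀

/-- The solution at time `|t|` of the Neumann heat equation whose datum is the Cole–Hopf transform
of `u₀`. -/
noncomputable def neumannHeat (t : ℝ) (u₀ : L2Unit) : C(unitInterval, ℝ) :=
  cosCoeff 0 (coleHopf κ u₀) • 1 + zeroMeanPrimitive (sineHeat hν t (heatDatum κ u₀))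

/-- The candidate solution at time `|t|` of the Burgers equation with datum `u₀`. -/
noncomputable def burgersFlow (t : ℝ) (u₀ : L2Unit) : L2Unit :=
  κ⁻¹ • mulL2 (Ring.inverse (neumannHeat hν κ t u₀)) (sineHeat hν t (heatDatum κ u₀))

lemma continuous_heatDatum : Continuous (heatDatum κ) :=
  (mulL2.isBoundedBilinearMap.continuous.comp
    ((continuous_coleHopf κ).prodMk continuous_id)).const_smul κ

lemma continuous_sineHeat_heatDatum :
    Continuous fun p : L2Unit × ℝ => sineHeat hν p.2 (heatDatum κ p.1) :=
  (continuous_sineHeat hν).comp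
    (((continuous_heatDatum κ).comp continuous_fst).prodMk continuous_snd)

lemma continuous_neumannHeat :
    Continuous fun p : L2Unit × ℝ => neumannHeat hν κ p.2 p.1 :=
  (((cosCoeff 0).continuous.comp ((continuous_coleHopf κ).comp continuous_fst)).smul
    continuous_const).add
      (zeroMeanPrimitive.continuous.comp (continuous_sineHeat_heatDatum hν κ))

/-- By `coleHopf_eq` the transform is a constant plus the primitive of the heat datum, so it is
recovered from its mean and that datum. -/
lemma neumannHeat_zero (u₀ : L2Unit) : neumannHeat hν κ 0 u₀ = coleHopf κ u₀ := by
  have h := coleHopf_eq κ u₀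
  have h' : cosCoeff 0 (coleHopf κ u₀) = 1 + cosCoeff 0 (primitive (heatDatum κ u₀)) := by
    conv_lhs => rw [h]
    rw [map_add, cosCoeff_zero_one]
    rfl
  rw [neumannHeat, sineHeat_zero, h']
  ext x
  conv_rhs => rw [h]
  simp only [ContinuousMap.add_apply, zeroMeanPrimitive_apply, ContinuousMap.smul_apply,
    ContinuousMap.one_apply, smul_eq_mul, heatDatum]
  ring

/-- The cosine coefficients of the solution of the Neumann heat equation. -/
noncomputable def neumannCoeff (κ : ℝ) (u₀ : L2Unit) (n : ℕ) : ℝ :=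
  -(√2 / ((n + 1) * Real.pi)) * inner ℝ (sineVec n) (heatDatum κ u₀)

lemma derivCoeff_neumannCoeff (u₀ : L2Unit) (n : ℕ) :
    derivCoeff (neumannCoeff κ u₀) n = -(√2 * inner ℝ (sineVec n) (heatDatum κ u₀)) := by
  have ha : ((n : ℝ) + 1) * Real.pi ≠ 0 := by positivity
  rw [derivCoeff, neumannCoeff]
  field_simp

lemma polyGrowth_derivCoeff_neumannCoeff (u₀ : L2Unit) :
    PolyGrowth (derivCoeff (neumannCoeff κ u₀)) := by
  refine ⟨√2 * ‖heatDatum κ u₀‖, 0, fun n => ?_⟩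
  rw [derivCoeff_neumannCoeff, abs_neg, abs_mul, abs_of_nonneg (Real.sqrt_nonneg _), pow_zero,
    mul_one]
  refine mul_le_mul_of_nonneg_left ?_ (Real.sqrt_nonneg _)
  have := abs_real_inner_le_norm (sineVec n) (heatDatum κ u₀)
  rwa [orthonormal_sineVec.1 n, one_mul] at this

lemma polyGrowth_neumannCoeff (u₀ : L2Unit) : PolyGrowth (neumannCoeff κ u₀) := by
  obtain ⟨C, k, h⟩ := polyGrowth_derivCoeff_neumannCoeff κ u₀
  refine ⟨C, k, fun n => le_trans ?_ (h n)⟩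
  rw [derivCoeff, abs_mul]
  refine le_mul_of_one_le_right (abs_nonneg _) ?_
  have hn : (0 : ℝ) ≤ n := n.cast_nonneg
  rw [abs_of_nonneg (by positivity)]
  nlinarith [Real.pi_gt_three]

/-- Point evaluation of the zero-mean primitive is a continuous functional on `L²`, so it may be
applied term by term to the sine expansion. -/
lemma neumannHeat_apply {t : ℝ} (ht : 0 < t) (u₀ : L2Unit) (x : unitInterval) :
    neumannHeat hν κ t u₀ x
      = cosCoeff 0 (coleHopf κ u₀) + heatSeries ν (neumannCoeff κ u₀) 0 t x := by
  have h := ((ContinuousMap.evalCLM ℝ x).comp zeroMeanPrimitive).hasSum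
    (hasSum_sineHeat hν ht.le (heatDatum κ u₀))
  rw [neumannHeat, ContinuousMap.add_apply, heatSeries]
  congr 1
  · simp
  · refine h.tsum_eq.symm.trans (tsum_congr fun n => ?_)
    simp only [ContinuousLinearMap.comp_apply, map_smul, ContinuousMap.evalCLM_apply,
      zeroMeanPrimitive_sineVec, smul_eq_mul, neumannCoeff, add_zero]
    ring

/-- For `t > 0` the sine expansion converges uniformly, hence the `L²` sum has a continuous
representative, which is the pointwise series. -/
lemma exists_sineHeat_eq_toL2 {t : ℝ} (ht : 0 < t) (u₀ : L2Unit) :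
    ∃ f : C(unitInterval, ℝ), sineHeat hν t (heatDatum κ u₀) = toL2 f ∧ ∀ x : unitInterval,
      f x = heatSeries ν (derivCoeff (neumannCoeff κ u₀)) (Real.pi / 2) t x := by
  set β : ℕ → ℝ := fun n => inner ℝ (sineVec n) (heatDatum κ u₀)
  have hs : Summable fun n => (heatFactor ν n t * β n) • (√2 • sinFun n) := by
    refine Summable.of_norm_bounded (summable_abs_mul_heatFactor hν
      (polyGrowth_derivCoeff_neumannCoeff κ u₀) ht) fun n => ?_
    rw [ContinuousMap.norm_le _ (mul_nonneg (abs_nonneg _) (heatFactor_pos _ _ _).le)]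
    intro x
    rw [derivCoeff_neumannCoeff, abs_neg, ContinuousMap.smul_apply, ContinuousMap.smul_apply,
      norm_smul, norm_smul, norm_mul, Real.norm_of_nonneg (heatFactor_pos _ _ _).le, abs_mul]
    calc _ ≤ heatFactor ν n t * ‖β n‖ * (‖√2‖ * 1) := by
          refine mul_le_mul_of_nonneg_left (mul_le_mul_of_nonneg_left (Real.abs_sin_le_one _)
            (norm_nonneg _)) (mul_nonneg (heatFactor_pos _ _ _).le (norm_nonneg _))
      _ = _ := by simp only [Real.norm_eq_abs, β]; ring
  refine ⟨∑' n, (heatFactor ν n t * β n) • (√2 • sinFun n), ?_, fun x => ?_⟩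
  · have h := toL2.hasSum hs.hasSum
    simp only [map_smul toL2 (heatFactor ν _ t * β _)] at h
    exact (hasSum_sineHeat hν ht.le (heatDatum κ u₀)).unique h
  · have h := (ContinuousMap.evalCLM ℝ x).hasSum hs.hasSum
    rw [ContinuousMap.evalCLM_apply] at h
    rw [← h.tsum_eq, heatSeries]
    refine tsum_congr fun n => ?_
    rw [derivCoeff_neumannCoeff, Real.cos_add_pi_div_two, ContinuousMap.evalCLM_apply]
    simp only [ContinuousMap.smul_apply, sinFun, ContinuousMap.coe_mk, smul_eq_mul, β]
    ring

/-- An even function of period 2 takes all its values on `[0, 1]`; bounds known there hold on the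
whole line. -/
lemma exists_unitInterval_heatSeries_eq (ν : ℝ) (b : ℕ → ℝ) (t x : ℝ) :
    ∃ z : unitInterval, heatSeries ν b 0 t z = heatSeries ν b 0 t x := by
  have hp : Function.Periodic (heatSeries ν b 0 t) 2 := heatSeries_add_two ν b 0 t
  obtain ⟨z, hz, h⟩ := hp.exists_mem_Ico₀ zero_lt_two x
  rcases le_or_gt z 1 with h1 | h1
  · exact ⟨⟨z, hz.1, h1⟩, h.symm⟩
  · refine ⟨⟨2 - z, by linarith [hz.2], by linarith⟩, ?_⟩
    rw [h, ← heatSeries_neg_zero ν b t z, ← heatSeries_add_two ν b 0 t (-z)]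
    congr 1
    change 2 - z = -z + 2
    ring

/-- The series is controlled only for positive times, so the minimum principle is started at a small
`δ > 0`. There `neumannHeat` is uniformly within `m / 2` of the initial transform, whose minimum is
`m > 0`. -/
lemma heatSeries_neumannCoeff_pos {ν : ℝ} (hν : 0 < ν) (κ : ℝ) (u₀ : L2Unit) {t : ℝ} (ht : 0 < t) (x : ℝ) :
    0 < cosCoeff 0 (coleHopf κ u₀) + heatSeries ν (neumannCoeff κ u₀) 0 t x := by
  obtain ⟨m, hm, hmle⟩ : ∃ m, 0 < m ∧ ∀ x, m ≤ coleHopf κ u₀ x := by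
    obtain ⟨x₀, -, hx₀⟩ := isCompact_univ.exists_isMinOn ⟨(0 : unitInterval), mem_univ _⟩
      (coleHopf κ u₀).continuous.continuousOn
    exact ⟨_, coleHopf_pos κ u₀ x₀, fun x => hx₀ (mem_univ x)⟩
  have hcont : Continuous fun t : ℝ => neumannHeat hν κ t u₀ :=
    (continuous_neumannHeat hν κ).comp (f := fun t : ℝ => (u₀, t)) (by fun_prop)
  have hev : ∀ᶠ s in nhdsWithin (0 : ℝ) (Ioi 0), ‖neumannHeat hν κ s u₀ - coleHopf κ u₀‖ < m / 2 := by
    refine Filter.Eventually.filter_mono nhdsWithin_le_nhds ?_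
    have h := (hcont.sub (continuous_const (y := coleHopf κ u₀))).norm.tendsto 0
    simp only [Pi.sub_apply, neumannHeat_zero, sub_self, norm_zero] at h
    exact h.eventually_lt_const (half_pos hm)
  obtain ⟨δ, hδ, hδ0, hδt⟩ := (hev.and (Ioo_mem_nhdsGT ht)).exists
  have hb := polyGrowth_neumannCoeff κ u₀
  refine lt_of_lt_of_le (half_pos hm) (heat_min_principle (ν := ν) (δ := δ) (m := m / 2)
    (fx := heatSeries ν (derivCoeff (neumannCoeff κ u₀)) (0 + Real.pi / 2))
    (fxx := heatSeries ν (derivCoeff (derivCoeff (neumannCoeff κ u₀)))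
      (0 + Real.pi / 2 + Real.pi / 2))
    (f := fun t x => cosCoeff 0 (coleHopf κ u₀) + heatSeries ν (neumannCoeff κ u₀) 0 t x)
    hδ0 ((continuousOn_heatSeries hν hb 0).const_add _)
    (fun t ht x => (hasDerivAt_heatSeries_x hν hb 0 x ht).const_add _)
    (fun t ht x => hasDerivAt_heatSeries_x hν hb.derivCoeff _ x ht)
    (fun t ht x => (hasDerivAt_heatSeries_t hν hb 0 x ht).const_add _) hν
    (fun t x => by simp only [heatSeries_add_two]) (fun x => ?_) hδt.le x)
  obtain ⟨z, hz⟩ := exists_unitInterval_heatSeries_eq ν (neumannCoeff κ u₀) δ x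
  rw [← hz, ← neumannHeat_apply hν κ hδ0]
  have h1 := (neumannHeat hν κ δ u₀ - coleHopf κ u₀).norm_coe_le_norm z
  have h2 := hmle z
  rw [ContinuousMap.sub_apply, Real.norm_eq_abs] at h1
  have := neg_le_of_abs_le h1
  linarith

lemma neumannHeat_pos (u₀ : L2Unit) {t : ℝ} (ht : 0 ≤ t) (x : unitInterval) :
    0 < neumannHeat hν κ t u₀ x := by
  rcases ht.eq_or_lt with rfl | ht
  · rw [neumannHeat_zero]; exact coleHopf_pos _ _ _
  · rw [neumannHeat_apply hν κ ht]; exact heatSeries_neumannCoeff_pos hν κ u₀ ht x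

lemma isUnit_neumannHeat (u₀ : L2Unit) {t : ℝ} (ht : 0 ≤ t) : IsUnit (neumannHeat hν κ t u₀) :=
  (ContinuousMap.isUnit_iff_forall_ne_zero _).2 fun x => (neumannHeat_pos hν κ u₀ ht x).ne'

lemma burgersFlow_zero (hκ : κ ≠ 0) (u₀ : L2Unit) : burgersFlow hν κ 0 u₀ = u₀ := by
  have hu := isUnit_neumannHeat hν κ u₀ le_rfl
  rw [burgersFlow, sineHeat_zero, heatDatum, map_smul, smul_smul, inv_mul_cancel₀ hκ, one_smul,
    mulL2_mulL2, ← neumannHeat_zero hν, Ring.inverse_mul_cancel _ hu, mulL2_one]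

lemma continuous_burgersFlow (T : ℝ) :
    Continuous fun p : L2Unit × Icc (0 : ℝ) T => burgersFlow hν κ p.2 p.1 := by
  have hι : Continuous fun p : L2Unit × Icc (0 : ℝ) T => (p.1, (p.2 : ℝ)) := by fun_prop
  have h₁ := (continuous_sineHeat_heatDatum hν κ).comp hι
  have h₂ : Continuous fun p : L2Unit × Icc (0 : ℝ) T =>
      Ring.inverse (neumannHeat hν κ p.2 p.1) := by
    rw [continuous_iff_continuousAt]
    intro p
    obtain ⟨U, hU⟩ := isUnit_neumannHeat hν κ p.1 p.2.2.1
    -- Positivity makes the heat solution a unit of the Banach algebra `C([0,1])`, where inversion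
    -- is continuous at units.
    have h := NormedRing.inverse_continuousAt U
    rw [hU] at h
    exact ContinuousAt.comp (f := fun p : L2Unit × Icc (0 : ℝ) T => neumannHeat hν κ p.2 p.1) h
      ((continuous_neumannHeat hν κ).comp hι).continuousAt
  have h₃ : Continuous fun p : L2Unit × Icc (0 : ℝ) T =>
      mulL2 (Ring.inverse (neumannHeat hν κ p.2 p.1)) (sineHeat hν p.2 (heatDatum κ p.1)) :=
    mulL2.isBoundedBilinearMap.continuous.comp
      (f := fun p : L2Unit × Icc (0 : ℝ) T =>
        (Ring.inverse (neumannHeat hν κ p.2 p.1), sineHeat hν p.2 (heatDatum κ p.1)))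
      (h₂.prodMk h₁)
  exact h₃.const_smul κ⁻¹

/-- The trajectory in `L²(0,1)` given by the Cole–Hopf formula. -/
noncomputable def burgersTrajectory (T : ℝ) (u₀ : L2Unit) : Trajectory T :=
  ⟨fun t => burgersFlow hν κ t u₀,
    (continuous_burgersFlow hν κ T).comp (f := fun t : Icc (0 : ℝ) T => (u₀, t)) (by fun_prop)⟩

/-- Joint continuity in datum and time, curried, is continuity into the space of trajectories. -/
lemma continuous_burgersTrajectory (T : ℝ) : Continuous (burgersTrajectory hν κ T) :=
  (ContinuousMap.curry ⟨_, continuous_burgersFlow hν κ T⟩).continuous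

end Flow

lemma solvesNudgedBurgers_burgersTrajectory {ν T : ℝ} (hν : 0 < ν) {k obs : ℝ → ℝ → ℝ}
    (hk : ∀ t ∈ Ioo 0 T, ∀ x ∈ Ioo (0 : ℝ) 1, k t x = 0) (u₀ : L2Unit) :
    SolvesNudgedBurgers ν T k obs (burgersTrajectory hν (-2 * ν)⁻¹ T u₀) := by
  set κ := (-2 * ν)⁻¹ with hκ
  have hb := polyGrowth_neumannCoeff κ u₀
  refine ⟨_, isClassicalNudgedBurgers_coleHopf hk
    (φ := fun t x => cosCoeff 0 (coleHopf κ u₀) + heatSeries ν (neumannCoeff κ u₀) 0 t x)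
    (fun t ht x => heatSeries_neumannCoeff_pos hν κ u₀ ht x)
    ((continuousOn_heatSeries hν hb 0).const_add _)
    (continuousOn_heatSeries hν hb.derivCoeff _)
    (continuousOn_heatSeries hν hb.derivCoeff.derivCoeff _)
    (continuousOn_heatSeries hν hb.derivCoeff.derivCoeff.derivCoeff _)
    (fun t ht x => (hasDerivAt_heatSeries_x hν hb 0 x ht).const_add _)
    (fun t ht x => hasDerivAt_heatSeries_x hν hb.derivCoeff _ x ht)
    (fun t ht x => hasDerivAt_heatSeries_x hν hb.derivCoeff.derivCoeff _ x ht)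
    (fun t ht x => (hasDerivAt_heatSeries_t hν hb 0 x ht).const_add _)
    (fun t ht x => hasDerivAt_heatSeries_t hν hb.derivCoeff _ x ht)
    (fun t => ?_) (fun t => ?_), ?_⟩
  · simpa using heatSeries_pi_div_two_eq_zero ν (derivCoeff (neumannCoeff κ u₀)) t 0
  · simpa using heatSeries_pi_div_two_eq_zero ν (derivCoeff (neumannCoeff κ u₀)) t 1
  · intro t ht
    obtain ⟨f, hf, hfx⟩ := exists_sineHeat_eq_toL2 hν κ ht u₀
    have hfl : burgersTrajectory hν κ T u₀ t
        = toL2 (κ⁻¹ • (Ring.inverse (neumannHeat hν κ t u₀) * f)) := by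
      change burgersFlow hν κ t u₀ = _
      rw [burgersFlow, hf, mulL2_toL2, map_smul]
    rw [hfl]
    filter_upwards [coeFn_toL2 (κ⁻¹ • (Ring.inverse (neumannHeat hν κ t u₀) * f)),
      ae_restrict_mem measurableSet_Ioo] with x hx hxI
    have hxI' := Ioo_subset_Icc_self hxI
    have hinv : Ring.inverse (neumannHeat hν κ t u₀) ⟨x, hxI'⟩
        = (neumannHeat hν κ t u₀ ⟨x, hxI'⟩)⁻¹ := by
      refine eq_inv_of_mul_eq_one_left ?_
      rw [← ContinuousMap.mul_apply,
        Ring.inverse_mul_cancel _ (isUnit_neumannHeat hν κ u₀ ht.le), ContinuousMap.one_apply]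
    rw [hx, extendI_of_mem _ hxI', ContinuousMap.smul_apply, ContinuousMap.mul_apply, hinv, hfx,
      neumannHeat_apply hν κ ht, zero_add, hκ, inv_inv, smul_eq_mul, inv_mul_eq_div]

/-! ### The Cole–Hopf transform of a classical solution -/

lemma hasDerivAt_intervalIntegral_of_bounded {f f' : ℝ → ℝ → ℝ} {a b t r C : ℝ} (hab : a ≤ b)
    (hr : 0 < r)
    (hd : ∀ s ∈ Ioo (t - r) (t + r), ∀ x ∈ Icc a b, HasDerivAt (fun s => f s x) (f' s x) s)
    (hc : ∀ s ∈ Ioo (t - r) (t + r), ContinuousOn (f s) (Icc a b))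
    (hc' : ContinuousOn (f' t) (Icc a b))
    (hC : ∀ s ∈ Ioo (t - r) (t + r), ∀ x ∈ Icc a b, |f' s x| ≤ C) :
    HasDerivAt (fun s => ∫ x in a..b, f s x) (∫ x in a..b, f' t x) t := by
  have hmem : Ioo (t - r) (t + r) ∈ nhds t := Ioo_mem_nhds (by linarith) (by linarith)
  have hsub : uIoc a b ⊆ Icc a b := by rw [uIoc_of_le hab]; exact Ioc_subset_Icc_self
  have hmeas : ∀ g : ℝ → ℝ, ContinuousOn g (Icc a b) →
      AEStronglyMeasurable g (volume.restrict (uIoc a b)) := fun g hg =>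
    (hg.mono hsub).aestronglyMeasurable measurableSet_uIoc
  refine (intervalIntegral.hasDerivAt_integral_of_dominated_loc_of_deriv_le (bound := fun _ => C)
    hmem ?_ ?_ (hmeas _ hc') ?_ (by simp) ?_).2
  · filter_upwards [hmem] with s hs using hmeas _ (hc s hs)
  · refine ContinuousOn.intervalIntegrable ?_
    rw [uIcc_of_le hab]
    exact hc t (mem_of_mem_nhds hmem)
  · exact Filter.Eventually.of_forall fun x hx s hs => hC s hs x (hsub hx)
  · exact Filter.Eventually.of_forall fun x hx s hs => hd s hs x (hsub hx)

lemma exists_abs_le_on_rectangle {f : ℝ → ℝ → ℝ} {S : Set (ℝ × ℝ)} {α β a b : ℝ}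
    (hf : ContinuousOn (fun p : ℝ × ℝ => f p.1 p.2) S) (hS : Icc α β ×ˢ Icc a b ⊆ S) :
    ∃ C, ∀ s ∈ Icc α β, ∀ x ∈ Icc a b, |f s x| ≤ C := by
  obtain ⟨C, hC⟩ := (isCompact_Icc.prod isCompact_Icc).exists_bound_of_continuousOn (hf.mono hS)
  exact ⟨C, fun s hs x hx => hC (s, x) ⟨hs, hx⟩⟩

/-- The viscous flux `ν ∂ₓw - w²/2`. -/
noncomputable def burgersFlux (ν : ℝ) (w : ℝ → ℝ → ℝ) (t x : ℝ) : ℝ :=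
  ν * deriv (w t) x - w t x ^ 2 / 2

/-- The Cole–Hopf transform of `w` with base point `a`. -/
noncomputable def coleHopfFrom (κ a : ℝ) (w : ℝ → ℝ → ℝ) (t x : ℝ) : ℝ :=
  Real.exp (κ * ∫ y in a..x, w t y)

section Classical

variable {ν T : ℝ} {k obs w : ℝ → ℝ → ℝ}

lemma Ioo_subset_Ioc_prod : Ioo 0 T ×ˢ Ioo (0 : ℝ) 1 ⊆ Ioc 0 T ×ˢ Icc (0 : ℝ) 1 :=
  prod_mono Ioo_subset_Ioc_self Ioo_subset_Icc_self

lemma IsClassicalNudgedBurgers.continuousOn_slice (hw : IsClassicalNudgedBurgers ν T k obs w)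
    {t : ℝ} (ht : t ∈ Ioc 0 T) : ContinuousOn (w t) (Icc 0 1) :=
  hw.continuousOn.comp (f := fun x => (t, x)) (by fun_prop) fun x hx => ⟨ht, hx⟩

lemma IsClassicalNudgedBurgers.intervalIntegrable (hw : IsClassicalNudgedBurgers ν T k obs w)
    {t : ℝ} (ht : t ∈ Ioc 0 T) {a b : ℝ} (ha : a ∈ Icc (0 : ℝ) 1) (hb : b ∈ Icc (0 : ℝ) 1) :
    IntervalIntegrable (w t) volume a b :=
  ((hw.continuousOn_slice ht).mono (uIcc_subset_Icc ha hb)).intervalIntegrable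

lemma IsClassicalNudgedBurgers.continuousOn_flux (hw : IsClassicalNudgedBurgers ν T k obs w) :
    ContinuousOn (fun p : ℝ × ℝ => burgersFlux ν w p.1 p.2) (Ioo 0 T ×ˢ Ioo 0 1) :=
  (hw.continuousOn_x.const_mul ν).sub
    (((hw.continuousOn.mono Ioo_subset_Ioc_prod).pow 2).div_const 2)

/-- The conservation form `∂ₜw = ∂ₓ(ν ∂ₓw - w²/2)` of the equation. -/
lemma IsClassicalNudgedBurgers.hasDerivAt_flux (hw : IsClassicalNudgedBurgers ν T k obs w)
    (hk : ∀ t ∈ Ioo 0 T, ∀ x ∈ Ioo (0 : ℝ) 1, k t x = 0) {t x : ℝ} (ht : t ∈ Ioo 0 T)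
    (hx : x ∈ Ioo (0 : ℝ) 1) :
    HasDerivAt (burgersFlux ν w t) (deriv (fun s => w s x) t) x := by
  have h₁ := (hw.differentiableAt_xx t ht x hx).hasDerivAt.const_mul ν
  have h₂ := ((hw.differentiableAt_x t ht x hx).hasDerivAt.fun_pow 2).div_const 2
  refine (h₁.sub h₂).congr_deriv ?_
  have he := hw.equation t ht x hx
  rw [hk t ht x hx] at he
  simp only [Nat.cast_ofNat, Nat.add_one_sub_one, pow_one]
  linarith

lemma exists_Icc_subset_Ioo {t : ℝ} (ht : t ∈ Ioo 0 T) :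
    ∃ r, 0 < r ∧ Icc (t - r) (t + r) ⊆ Ioo 0 T := by
  refine ⟨min t (T - t) / 2, half_pos (lt_min ht.1 (sub_pos.2 ht.2)), fun s hs => ?_⟩
  have h1 := min_le_left t (T - t)
  have h2 := min_le_right t (T - t)
  have h3 := lt_min ht.1 (sub_pos.2 ht.2)
  exact ⟨by linarith [hs.1], by linarith [hs.2]⟩

lemma IsClassicalNudgedBurgers.hasDerivAt_integral (hw : IsClassicalNudgedBurgers ν T k obs w)
    (hk : ∀ t ∈ Ioo 0 T, ∀ x ∈ Ioo (0 : ℝ) 1, k t x = 0) {t a x : ℝ} (ht : t ∈ Ioo 0 T)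
    (ha : 0 < a) (hax : a ≤ x) (hx : x < 1) :
    HasDerivAt (fun s => ∫ y in a..x, w s y) (burgersFlux ν w t x - burgersFlux ν w t a) t := by
  obtain ⟨r, hr, hsub⟩ := exists_Icc_subset_Ioo ht
  have hI : Icc a x ⊆ Ioo 0 1 := fun y hy => ⟨ha.trans_le hy.1, hy.2.trans_lt hx⟩
  obtain ⟨C, hC⟩ := exists_abs_le_on_rectangle (f := fun s x => deriv (fun s => w s x) s)
    hw.continuousOn_t (prod_mono hsub hI)
  have hct : ContinuousOn (fun y => deriv (fun s => w s y) t) (Icc a x) :=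
    hw.continuousOn_t.comp (f := fun y => (t, y)) (by fun_prop) fun y hy => ⟨ht, hI hy⟩
  have h := hasDerivAt_intervalIntegral_of_bounded (f := w)
    (f' := fun s x => deriv (fun s => w s x) s) (C := C) hax hr
    (fun s hs y hy => (hw.differentiableAt_t s (hsub (Ioo_subset_Icc_self hs)) y
      (hI hy)).hasDerivAt)
    (fun s hs => (hw.continuousOn_slice (Ioo_subset_Ioc_self
      (hsub (Ioo_subset_Icc_self hs)))).mono (hI.trans Ioo_subset_Icc_self))
    hct (fun s hs => hC s (Ioo_subset_Icc_self hs))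
  refine h.congr_deriv ?_
  refine intervalIntegral.integral_eq_sub_of_hasDerivAt (fun y hy => ?_) ?_
  · rw [uIcc_of_le hax] at hy
    exact hw.hasDerivAt_flux hk ht (hI hy)
  · exact ContinuousOn.intervalIntegrable (by rwa [uIcc_of_le hax])

/-- When `νκ = -1/2`, `κ` times the flux at `x` times the transform `ψ` is `ν ∂ₓₓψ`. Thus `ψ` solves
the heat equation up to the term `-κ F(t, a) ψ`, with `F` the flux, whose coefficient depends on
time only. -/
lemma IsClassicalNudgedBurgers.hasDerivAt_coleHopfFrom_t
    (hw : IsClassicalNudgedBurgers ν T k obs w)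
    (hk : ∀ t ∈ Ioo 0 T, ∀ x ∈ Ioo (0 : ℝ) 1, k t x = 0) (κ : ℝ) {t a x : ℝ} (ht : t ∈ Ioo 0 T)
    (ha : 0 < a) (hax : a ≤ x) (hx : x < 1) :
    HasDerivAt (fun s => coleHopfFrom κ a w s x)
      (κ * (burgersFlux ν w t x - burgersFlux ν w t a) * coleHopfFrom κ a w t x) t :=
  ((hw.hasDerivAt_integral hk ht ha hax hx).const_mul κ).exp.congr_deriv (mul_comm _ _)

lemma IsClassicalNudgedBurgers.hasDerivAt_coleHopfFrom_x
    (hw : IsClassicalNudgedBurgers ν T k obs w) (κ : ℝ) {t a x : ℝ} (ht : t ∈ Ioc 0 T)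
    (ha : a ∈ Icc (0 : ℝ) 1) (hx : x ∈ Ioo (0 : ℝ) 1) :
    HasDerivAt (coleHopfFrom κ a w t) (κ * w t x * coleHopfFrom κ a w t x) x := by
  have hc := (hw.continuousOn_slice ht).mono Ioo_subset_Icc_self
  have h := intervalIntegral.integral_hasDerivAt_right
    (hw.intervalIntegrable ht ha (Ioo_subset_Icc_self hx))
    (hc.stronglyMeasurableAtFilter isOpen_Ioo x hx) (hc.continuousAt (isOpen_Ioo.mem_nhds hx))
  exact (h.const_mul κ).exp.congr_deriv (mul_comm _ _)

lemma abs_mul_integral_le {κ a M t x : ℝ} (hM : ∀ y ∈ Icc (0 : ℝ) 1, |w t y| ≤ M)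
    (ha : a ∈ Icc (0 : ℝ) 1) (hx : x ∈ Icc (0 : ℝ) 1) :
    |κ * ∫ y in a..x, w t y| ≤ |κ| * M := by
  have hM0 : 0 ≤ M := (abs_nonneg _).trans (hM a ha)
  rw [abs_mul]
  refine mul_le_mul_of_nonneg_left ?_ (abs_nonneg _)
  have h := intervalIntegral.norm_integral_le_of_norm_le_const (a := a) (b := x) (f := w t)
    (C := M) fun y hy => hM y (uIcc_subset_Icc ha hx (uIoc_subset_uIcc hy))
  refine h.trans (mul_le_of_le_one_right hM0 ?_)
  rw [abs_le]
  exact ⟨by linarith [hx.1, ha.2], by linarith [hx.2, ha.1]⟩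

/-- The cosine coefficients on `[a,b]` of the Cole–Hopf transform with base point `a`. -/
noncomputable def coleHopfCoeff (κ a b : ℝ) (w : ℝ → ℝ → ℝ) (n : ℕ) (t : ℝ) : ℝ :=
  ∫ x in a..b, coleHopfFrom κ a w t x * Real.cos (n * Real.pi * x)

/-- The boundary terms in the evolution of the cosine coefficients of the Cole–Hopf transform. -/
noncomputable def coleHopfBoundary (κ a : ℝ) (w : ℝ → ℝ → ℝ) (n : ℕ) (t x : ℝ) : ℝ :=
  κ * w t x * coleHopfFrom κ a w t x * Real.cos (n * Real.pi * x)
    + n * Real.pi * (coleHopfFrom κ a w t x * Real.sin (n * Real.pi * x))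

lemma IsClassicalNudgedBurgers.hasDerivAt_coleHopfBoundary
    (hw : IsClassicalNudgedBurgers ν T k obs w) {κ : ℝ} (hκ : ν * κ = -1 / 2) (n : ℕ)
    {t a x : ℝ} (ht : t ∈ Ioo 0 T) (ha : a ∈ Icc (0 : ℝ) 1) (hx : x ∈ Ioo (0 : ℝ) 1) :
    HasDerivAt (fun y => ν * coleHopfBoundary κ a w n t y)
      (κ * burgersFlux ν w t x * (coleHopfFrom κ a w t x * Real.cos (n * Real.pi * x))
        + ν * (n * Real.pi) ^ 2 * (coleHopfFrom κ a w t x * Real.cos (n * Real.pi * x))) x := by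
  have hψ := hw.hasDerivAt_coleHopfFrom_x κ (Ioo_subset_Ioc_self ht) ha hx
  have hwx := (hw.differentiableAt_x t ht x hx).hasDerivAt
  have hl : HasDerivAt (fun y : ℝ => n * Real.pi * y) (n * Real.pi) x := by
    simpa using (hasDerivAt_id x).const_mul (n * Real.pi)
  have h := ((((hwx.const_mul κ).mul hψ).mul hl.cos).add ((hψ.mul hl.sin).const_mul
    (n * Real.pi))).const_mul ν
  refine h.congr_deriv ?_
  rw [burgersFlux]
  simp only [Pi.mul_apply]
  linear_combination (κ * w t x ^ 2 * coleHopfFrom κ a w t x * Real.cos (n * Real.pi * x)) * hκ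

/-- Differentiation under the integral followed by two integrations by parts against the cosine. The
flux at `a` enters through a factor that is the same for all `n`. -/
lemma IsClassicalNudgedBurgers.hasDerivAt_coleHopfCoeff
    (hw : IsClassicalNudgedBurgers ν T k obs w)
    (hk : ∀ t ∈ Ioo 0 T, ∀ x ∈ Ioo (0 : ℝ) 1, k t x = 0) {κ : ℝ} (hκ : ν * κ = -1 / 2) (n : ℕ)
    {t a b : ℝ} (ht : t ∈ Ioo 0 T) (ha : 0 < a) (hab : a ≤ b) (hb : b < 1) :
    HasDerivAt (coleHopfCoeff κ a b w n)
      (ν * (coleHopfBoundary κ a w n t b - coleHopfBoundary κ a w n t a)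
        - (ν * (n * Real.pi) ^ 2 + κ * burgersFlux ν w t a) * coleHopfCoeff κ a b w n t) t := by
  obtain ⟨r, hr, hsub⟩ := exists_Icc_subset_Ioo ht
  have hI : Icc a b ⊆ Ioo 0 1 := fun y hy => ⟨ha.trans_le hy.1, hy.2.trans_lt hb⟩
  have haI : a ∈ Icc (0 : ℝ) 1 := ⟨ha.le, (hab.trans_lt hb).le⟩
  obtain ⟨C, hC⟩ := exists_abs_le_on_rectangle hw.continuousOn_flux (prod_mono hsub hI)
  obtain ⟨M, hM⟩ := exists_abs_le_on_rectangle (f := w) (a := 0) (b := 1) hw.continuousOn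
    (prod_mono (hsub.trans Ioo_subset_Ioc_self) le_rfl)
  have hψc : ∀ s ∈ Ioo 0 T, ContinuousOn (coleHopfFrom κ a w s) (Icc a b) := fun s hs y hy =>
    (hw.hasDerivAt_coleHopfFrom_x κ (Ioo_subset_Ioc_self hs) haI
      (hI hy)).continuousAt.continuousWithinAt
  have hFc : ContinuousOn (burgersFlux ν w t) (Icc a b) := fun y hy =>
    (hw.hasDerivAt_flux hk ht (hI hy)).continuousAt.continuousWithinAt
  have hcos : Continuous fun x : ℝ => Real.cos (n * Real.pi * x) := by fun_prop
  have h := hasDerivAt_intervalIntegral_of_bounded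
    (f := fun s x => coleHopfFrom κ a w s x * Real.cos (n * Real.pi * x))
    (f' := fun s x => κ * (burgersFlux ν w s x - burgersFlux ν w s a) * coleHopfFrom κ a w s x
      * Real.cos (n * Real.pi * x)) (t := t) (C := |κ| * (C + C) * Real.exp (|κ| * M) * 1) hab hr
    (fun s hs y hy => (hw.hasDerivAt_coleHopfFrom_t hk κ (hsub (Ioo_subset_Icc_self hs)) ha hy.1
      (hy.2.trans_lt hb)).mul_const _)
    (fun s hs => (hψc s (hsub (Ioo_subset_Icc_self hs))).mul hcos.continuousOn)
    ((((hFc.sub continuousOn_const).const_mul κ).mul (hψc t ht)).mul hcos.continuousOn) ?_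
  · refine h.congr_deriv ?_
    have hB : ∫ x in a..b, (κ * burgersFlux ν w t x * (coleHopfFrom κ a w t x
        * Real.cos (n * Real.pi * x)) + ν * (n * Real.pi) ^ 2 * (coleHopfFrom κ a w t x
          * Real.cos (n * Real.pi * x))) =
        ν * coleHopfBoundary κ a w n t b - ν * coleHopfBoundary κ a w n t a := by
      refine intervalIntegral.integral_eq_sub_of_hasDerivAt
        (f := fun y => ν * coleHopfBoundary κ a w n t y) (fun y hy => ?_) ?_
      · rw [uIcc_of_le hab] at hy
        exact hw.hasDerivAt_coleHopfBoundary hκ n ht haI (hI hy)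
      · refine ContinuousOn.intervalIntegrable ?_
        rw [uIcc_of_le hab]
        exact ((hFc.const_mul κ).mul ((hψc t ht).mul hcos.continuousOn)).add
          (((hψc t ht).mul hcos.continuousOn).const_mul _)
    rw [mul_sub, ← hB, coleHopfCoeff, ← intervalIntegral.integral_const_mul,
      ← intervalIntegral.integral_sub]
    · refine intervalIntegral.integral_congr fun x _ => ?_
      ring
    all_goals
      refine ContinuousOn.intervalIntegrable ?_
      rw [uIcc_of_le hab]
    · exact ((hFc.const_mul κ).mul ((hψc t ht).mul hcos.continuousOn)).add
          (((hψc t ht).mul hcos.continuousOn).const_mul _)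
    · exact ((hψc t ht).mul hcos.continuousOn).const_mul _
  · intro s hs y hy
    have hs' := Ioo_subset_Icc_self hs
    have h1 := hC s hs' y hy
    have h2 := hC s hs' a (left_mem_Icc.2 hab)
    have hC0 : 0 ≤ C := (abs_nonneg _).trans h1
    have h3 : |coleHopfFrom κ a w s y| ≤ Real.exp (|κ| * M) := by
      rw [coleHopfFrom, Real.abs_exp, Real.exp_le_exp]
      exact (le_abs_self _).trans
        (abs_mul_integral_le (hM s hs') haI (Ioo_subset_Icc_self (hI hy)))
    rw [abs_mul, abs_mul, abs_mul]
    have h4 : |burgersFlux ν w s y - burgersFlux ν w s a| ≤ C + C :=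
      (abs_sub _ _).trans (add_le_add h1 h2)
    gcongr
    exact Real.abs_cos_le_one _

end Classical

/-! ### Evolution of the normalised cosine coefficients -/

section Quotient

variable {ν T : ℝ} {k obs w : ℝ → ℝ → ℝ}

/-- The quotient of two cosine coefficients, rescaled so as to be constant for the heat equation. -/
noncomputable def coleHopfQuotient (ν κ a b : ℝ) (w : ℝ → ℝ → ℝ) (n : ℕ) (t : ℝ) : ℝ :=
  Real.exp (ν * (n * Real.pi) ^ 2 * t) * (coleHopfCoeff κ a b w n t / coleHopfCoeff κ a b w 0 t)

/-- Dividing by the zeroth coefficient cancels the flux at `a`, the exponential cancels the decay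
rate, and only boundary terms free of `∂ₓw` survive. -/
lemma IsClassicalNudgedBurgers.hasDerivAt_coleHopfQuotient
    (hw : IsClassicalNudgedBurgers ν T k obs w)
    (hk : ∀ t ∈ Ioo 0 T, ∀ x ∈ Ioo (0 : ℝ) 1, k t x = 0) {κ : ℝ} (hκ : ν * κ = -1 / 2) (n : ℕ)
    {t a b : ℝ} (ht : t ∈ Ioo 0 T) (ha : 0 < a) (hab : a ≤ b) (hb : b < 1)
    (h0 : coleHopfCoeff κ a b w 0 t ≠ 0) :
    HasDerivAt (coleHopfQuotient ν κ a b w n)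
      (Real.exp (ν * (n * Real.pi) ^ 2 * t) * (ν *
        (((coleHopfBoundary κ a w n t b - coleHopfBoundary κ a w n t a)
        - coleHopfCoeff κ a b w n t / coleHopfCoeff κ a b w 0 t *
          (coleHopfBoundary κ a w 0 t b - coleHopfBoundary κ a w 0 t a))
          / coleHopfCoeff κ a b w 0 t))) t := by
  have hn := hw.hasDerivAt_coleHopfCoeff hk hκ n ht ha hab hb
  have hz := hw.hasDerivAt_coleHopfCoeff hk hκ 0 ht ha hab hb
  have he : HasDerivAt (fun t => Real.exp (ν * (n * Real.pi) ^ 2 * t))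
      (Real.exp (ν * (n * Real.pi) ^ 2 * t) * (ν * (n * Real.pi) ^ 2 * 1)) t :=
    ((hasDerivAt_id t).const_mul _).exp
  refine (he.mul (hn.div hz h0)).congr_deriv ?_
  simp only [Pi.div_apply]
  push_cast
  field_simp
  ring

lemma abs_coleHopfBoundary_le {κ a M ε t x : ℝ} (hM : ∀ y ∈ Icc (0 : ℝ) 1, |w t y| ≤ M)
    (ha : a ∈ Icc (0 : ℝ) 1) (hx : x ∈ Icc (0 : ℝ) 1) (n : ℕ) (hwx : |w t x| ≤ ε)
    (hsin : |Real.sin (n * Real.pi * x)| ≤ ε) :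
    |coleHopfBoundary κ a w n t x| ≤ (|κ| + n * Real.pi) * Real.exp (|κ| * M) * ε := by
  have h3 : |coleHopfFrom κ a w t x| ≤ Real.exp (|κ| * M) := by
    rw [coleHopfFrom, Real.abs_exp, Real.exp_le_exp]
    exact (le_abs_self _).trans (abs_mul_integral_le hM ha hx)
  have hε : 0 ≤ ε := (abs_nonneg _).trans hwx
  have hπ := Real.pi_pos.le
  have h₁ : |κ * w t x * coleHopfFrom κ a w t x * Real.cos (n * Real.pi * x)|
      ≤ |κ| * ε * Real.exp (|κ| * M) * 1 := by
    rw [abs_mul, abs_mul, abs_mul]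
    gcongr
    exact Real.abs_cos_le_one _
  have h₂ : |n * Real.pi * (coleHopfFrom κ a w t x * Real.sin (n * Real.pi * x))|
      ≤ n * Real.pi * (Real.exp (|κ| * M) * ε) := by
    rw [abs_mul, abs_mul (coleHopfFrom κ a w t x),
      abs_of_nonneg (by positivity : 0 ≤ n * Real.pi)]
    gcongr
  refine (abs_add_le _ _).trans ((add_le_add h₁ h₂).trans (le_of_eq ?_))
  ring

/-- Mean value inequality, with a constant that does not depend on `a` and `b`. The zeroth
coefficient dominates the others and, since `b - a ≥ 1/2`, is at least `exp (-|κ| M) / 2`; each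
boundary term is of order `ε`. -/
lemma IsClassicalNudgedBurgers.abs_coleHopfQuotient_sub_le
    (hw : IsClassicalNudgedBurgers ν T k obs w) (hν : 0 < ν)
    (hk : ∀ t ∈ Ioo 0 T, ∀ x ∈ Ioo (0 : ℝ) 1, k t x = 0) {κ : ℝ} (hκ : ν * κ = -1 / 2) (n : ℕ)
    {α β a b M ε : ℝ} (hα : 0 < α) (hαβ : α ≤ β) (hβ : β < T) (ha : 0 < a) (hab : 1 / 2 ≤ b - a)
    (hb : b < 1) (hM : ∀ s ∈ Icc α β, ∀ y ∈ Icc (0 : ℝ) 1, |w s y| ≤ M)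
    (hwa : ∀ s ∈ Icc α β, |w s a| ≤ ε) (hwb : ∀ s ∈ Icc α β, |w s b| ≤ ε)
    (hsa : |Real.sin (n * Real.pi * a)| ≤ ε) (hsb : |Real.sin (n * Real.pi * b)| ≤ ε) :
    |coleHopfQuotient ν κ a b w n β - coleHopfQuotient ν κ a b w n α| ≤
      Real.exp (ν * (n * Real.pi) ^ 2 * β) * (ν * ((4 * |κ| + 2 * (n * Real.pi)) *
        (2 * Real.exp (|κ| * M) ^ 2))) * ε * (β - α) := by
  have hab' : a ≤ b := by linarith
  have hIcc : Icc a b ⊆ Icc 0 1 := Icc_subset_Icc ha.le hb.le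
  have haI := hIcc (left_mem_Icc.2 hab')
  have hbI := hIcc (right_mem_Icc.2 hab')
  have hε : 0 ≤ ε := (abs_nonneg _).trans hsa
  have hIT : ∀ s ∈ Icc α β, s ∈ Ioo 0 T := fun s hs => ⟨hα.trans_le hs.1, hs.2.trans_lt hβ⟩
  have hK := Real.exp_pos (|κ| * M)
  have hψc : ∀ s ∈ Icc α β, ContinuousOn (coleHopfFrom κ a w s) (Icc a b) := fun s hs y hy =>
    (hw.hasDerivAt_coleHopfFrom_x κ (Ioo_subset_Ioc_self (hIT s hs)) haI
      ⟨ha.trans_le hy.1, hy.2.trans_lt hb⟩).continuousAt.continuousWithinAt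
  have hint : ∀ s ∈ Icc α β, ∀ m : ℕ, IntervalIntegrable
      (fun x => coleHopfFrom κ a w s x * Real.cos (m * Real.pi * x)) volume a b := by
    intro s hs m
    refine ContinuousOn.intervalIntegrable ?_
    rw [uIcc_of_le hab']
    exact (hψc s hs).mul (by fun_prop)
  have hA0 : ∀ s ∈ Icc α β, (2 * Real.exp (|κ| * M))⁻¹ ≤ coleHopfCoeff κ a b w 0 s := by
    intro s hs
    have h : ∫ _ : ℝ in a..b, (Real.exp (|κ| * M))⁻¹ ≤ coleHopfCoeff κ a b w 0 s := by
      refine intervalIntegral.integral_mono_on hab' (by simp) (hint s hs 0) fun x hx => ?_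
      rw [Nat.cast_zero, zero_mul, zero_mul, Real.cos_zero, mul_one, coleHopfFrom, ← Real.exp_neg,
        Real.exp_le_exp]
      exact neg_le_of_abs_le (abs_mul_integral_le (hM s hs) haI (hIcc hx))
    refine le_trans ?_ h
    rw [intervalIntegral.integral_const, smul_eq_mul, mul_inv]
    exact mul_le_mul_of_nonneg_right (by linarith) (inv_nonneg.2 hK.le)
  have hA0p : ∀ s ∈ Icc α β, 0 < coleHopfCoeff κ a b w 0 s := fun s hs =>
    lt_of_lt_of_le (by positivity) (hA0 s hs)
  have hAn : ∀ s ∈ Icc α β, |coleHopfCoeff κ a b w n s| ≤ coleHopfCoeff κ a b w 0 s := by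
    intro s hs
    refine intervalIntegral.norm_integral_le_of_norm_le
      (f := fun x => coleHopfFrom κ a w s x * Real.cos (n * Real.pi * x)) hab'
      (Filter.Eventually.of_forall fun x _ => ?_) (hint s hs 0)
    rw [Nat.cast_zero, zero_mul, zero_mul, Real.cos_zero, mul_one, norm_mul, coleHopfFrom,
      Real.norm_of_nonneg (Real.exp_pos _).le]
    exact mul_le_of_le_one_right (Real.exp_pos _).le (Real.abs_cos_le_one _)
  have hmv := norm_image_sub_le_of_norm_deriv_le_segment'
    (fun s hs => (hw.hasDerivAt_coleHopfQuotient hk hκ n (hIT s hs) ha hab' hb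
      (hA0p s hs).ne').hasDerivWithinAt)
    (C := Real.exp (ν * (n * Real.pi) ^ 2 * β) * (ν * ((4 * |κ| + 2 * (n * Real.pi)) *
        (2 * Real.exp (|κ| * M) ^ 2))) * ε) (fun s hs => ?_) β (right_mem_Icc.2 hαβ)
  · exact hmv
  · have hs := Ico_subset_Icc_self hs
    -- Needed for `m = n` and `m = 0`: the two bounds add up to the factor `2(|κ| + nπ) + 2|κ|` of
    -- the constant.
    have hB : ∀ m : ℕ, |Real.sin (m * Real.pi * a)| ≤ ε → |Real.sin (m * Real.pi * b)| ≤ ε →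
        |coleHopfBoundary κ a w m s b - coleHopfBoundary κ a w m s a|
          ≤ 2 * ((|κ| + m * Real.pi) * Real.exp (|κ| * M) * ε) := by
      intro m h1 h2
      refine (abs_sub _ _).trans ?_
      rw [two_mul]
      exact add_le_add (abs_coleHopfBoundary_le (hM s hs) haI hbI m (hwb s hs) h2)
        (abs_coleHopfBoundary_le (hM s hs) haI haI m (hwa s hs) h1)
    have hBn := hB n hsa hsb
    have hB0 := hB 0 (by simpa using hε) (by simpa using hε)
    have hD : |coleHopfCoeff κ a b w n s / coleHopfCoeff κ a b w 0 s| ≤ 1 := by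
      rw [abs_div, abs_of_pos (hA0p s hs), div_le_one (hA0p s hs)]
      exact hAn s hs
    have hinv : (coleHopfCoeff κ a b w 0 s)⁻¹ ≤ 2 * Real.exp (|κ| * M) := by
      rw [inv_le_comm₀ (hA0p s hs) (by positivity)]
      exact hA0 s hs
    have hinv0 := inv_nonneg.2 (hA0p s hs).le
    have hnum : _ ≤ _ + 1 * (2 * ((|κ| + (0 : ℕ) * Real.pi) * Real.exp (|κ| * M) * ε)) := (abs_sub (coleHopfBoundary κ a w n s b - coleHopfBoundary κ a w n s a)
      (coleHopfCoeff κ a b w n s / coleHopfCoeff κ a b w 0 s *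
          (coleHopfBoundary κ a w 0 s b - coleHopfBoundary κ a w 0 s a))).trans
      (add_le_add hBn (by rw [abs_mul]; exact mul_le_mul hD hB0 (abs_nonneg _) zero_le_one))
    rw [norm_mul, norm_mul, div_eq_mul_inv, norm_mul, Real.norm_of_nonneg (Real.exp_pos _).le,
      Real.norm_of_nonneg hν.le, Real.norm_of_nonneg hinv0, Real.norm_eq_abs]
    have hexp : Real.exp (ν * (n * Real.pi) ^ 2 * s) ≤ Real.exp (ν * (n * Real.pi) ^ 2 * β) := by
      rw [Real.exp_le_exp]
      exact mul_le_mul_of_nonneg_left hs.2 (by positivity)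
    have hπ := Real.pi_pos.le
    calc _ ≤ Real.exp (ν * (n * Real.pi) ^ 2 * β) * (ν *
          ((2 * ((|κ| + n * Real.pi) * Real.exp (|κ| * M) * ε) + 1 *
            (2 * ((|κ| + (0 : ℕ) * Real.pi) * Real.exp (|κ| * M) * ε))) *
              (2 * Real.exp (|κ| * M)))) := by
          gcongr
      _ = _ := by push_cast; ring

end Quotient

/-- The normalised cosine coefficients of the Cole–Hopf transform. -/
noncomputable def normCoeff (κ : ℝ) (n : ℕ) (g : L2Unit) : ℝ :=
  cosCoeff n (coleHopf κ g) / cosCoeff 0 (coleHopf κ g)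

lemma cosCoeff_zero_coleHopf_pos (κ : ℝ) (g : L2Unit) : 0 < cosCoeff 0 (coleHopf κ g) :=
  cosCoeff_zero_pos (coleHopf_pos κ g)

lemma continuous_normCoeff (κ : ℝ) (n : ℕ) : Continuous (normCoeff κ n) :=
  ((cosCoeff n).continuous.comp (continuous_coleHopf κ)).div₀
    ((cosCoeff 0).continuous.comp (continuous_coleHopf κ))
    fun g => (cosCoeff_zero_coleHopf_pos κ g).ne'

lemma tendsto_integral_shrinking {f : ℝ → ℝ} (hf : Continuous f) :
    Filter.Tendsto (fun δ => ∫ x in δ..(1 - δ), f x) (nhdsWithin 0 (Ioi 0))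
      (nhds (∫ x in (0 : ℝ)..1, f x)) := by
  have hp := intervalIntegral.continuous_primitive (fun a b => hf.intervalIntegrable (μ := volume) a b) 0
  have h : Continuous fun δ : ℝ => (∫ x in (0 : ℝ)..(1 - δ), f x) - ∫ x in (0 : ℝ)..δ, f x :=
    (hp.comp (f := fun δ : ℝ => 1 - δ) (by fun_prop)).sub hp
  have h' := h.tendsto 0
  simp only [sub_zero, intervalIntegral.integral_same] at h'
  refine (h'.mono_left nhdsWithin_le_nhds).congr fun δ => ?_
  exact intervalIntegral.integral_interval_sub_left (hf.intervalIntegrable _ _)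
    (hf.intervalIntegrable _ _)

section Trajectory

variable {ν T : ℝ} {k obs w : ℝ → ℝ → ℝ}

/-- Moving the base point from `0` to `δ` multiplies all the coefficients by one common factor,
which the quotient does not see; then the interval `[δ, 1 - δ]` fills `[0, 1]`. -/
lemma IsClassicalNudgedBurgers.tendsto_coleHopfQuotient
    (hw : IsClassicalNudgedBurgers ν T k obs w) (κ : ℝ) (n : ℕ) {t : ℝ} (ht : t ∈ Ioc 0 T)
    {g : L2Unit} (hg : (g : ℝ → ℝ) =ᵐ[volume.restrict (Ioo (0 : ℝ) 1)] w t) :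
    Filter.Tendsto (fun δ => coleHopfQuotient ν κ δ (1 - δ) w n t) (nhdsWithin 0 (Ioi 0))
      (nhds (Real.exp (ν * (n * Real.pi) ^ 2 * t) * normCoeff κ n g)) := by
  refine Filter.Tendsto.const_mul _ ?_
  have hcont : ∀ m : ℕ, Continuous fun x => extendI (coleHopf κ g) x * Real.cos (m * Real.pi * x) :=
    fun m => (continuous_extendI _).mul (by fun_prop)
  have hlim := (tendsto_integral_shrinking (hcont n)).div (tendsto_integral_shrinking (hcont 0))
    (cosCoeff_zero_coleHopf_pos κ g).ne'
  refine hlim.congr' ?_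
  filter_upwards [Ioo_mem_nhdsGT (show (0 : ℝ) < 1 / 2 by norm_num)] with δ hδ
  have hδI : δ ∈ Icc (0 : ℝ) 1 := ⟨hδ.1.le, by linarith [hδ.2]⟩
  have key : ∀ m : ℕ, coleHopfCoeff κ δ (1 - δ) w m t = Real.exp (-(κ * ∫ y in (0 : ℝ)..δ, w t y)) *
      ∫ x in δ..(1 - δ), extendI (coleHopf κ g) x * Real.cos (m * Real.pi * x) := by
    intro m
    rw [coleHopfCoeff, ← intervalIntegral.integral_const_mul]
    refine intervalIntegral.integral_congr fun x hx => ?_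
    rw [uIcc_of_le (by linarith [hδ.2])] at hx
    have hxI : x ∈ Icc (0 : ℝ) 1 := ⟨hδ.1.le.trans hx.1, by linarith [hx.2, hδ.1]⟩
    have h0I : (0 : ℝ) ∈ Icc (0 : ℝ) 1 := left_mem_Icc.2 zero_le_one
    rw [extendI_of_mem _ hxI, coleHopf_apply, primitive_apply,
      intervalIntegral_congr_ae_Ioo hg h0I hxI, ← mul_assoc, ← Real.exp_add, coleHopfFrom,
      ← intervalIntegral.integral_add_adjacent_intervals (hw.intervalIntegrable ht h0I hδI)
        (hw.intervalIntegrable ht hδI hxI)]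
    congr 2
    ring
  rw [key n, key 0, mul_div_mul_left _ _ (Real.exp_pos _).ne', Pi.div_apply]

/-- Uniform continuity on `[α, β] × [0, 1]` makes the boundary condition hold approximately near the
end points, uniformly in time. -/
lemma IsClassicalNudgedBurgers.eventually_boundary_small
    (hw : IsClassicalNudgedBurgers ν T k obs w) {α β ε : ℝ} (hα : 0 < α) (hβ : β ≤ T)
    (hε : 0 < ε) : ∀ᶠ δ in nhdsWithin (0 : ℝ) (Ioi 0),
      (∀ s ∈ Icc α β, |w s δ| ≤ ε) ∧ ∀ s ∈ Icc α β, |w s (1 - δ)| ≤ ε := by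
  have hsub : Icc α β ⊆ Ioc 0 T := fun s hs => ⟨hα.trans_le hs.1, hs.2.trans hβ⟩
  have hu := (isCompact_Icc.prod isCompact_Icc).uniformContinuousOn_of_continuous
    (hw.continuousOn.mono (prod_mono hsub (le_refl (Icc (0 : ℝ) 1))))
  rw [Metric.uniformContinuousOn_iff] at hu
  obtain ⟨η, hη, h⟩ := hu ε hε
  filter_upwards [Ioo_mem_nhdsGT (lt_min hη zero_lt_one)] with δ hδ
  have hδη := hδ.2.trans_le (min_le_left _ _)
  have hδ1 := hδ.2.trans_le (min_le_right _ _)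
  constructor
  · intro s hs
    have h' := h (s, δ) ⟨hs, hδ.1.le, hδ1.le⟩ (s, 0) ⟨hs, by simp⟩ (by
      rw [Prod.dist_eq, dist_self, Real.dist_eq, sub_zero, abs_of_pos hδ.1]
      exact max_lt hη hδη)
    simp only [hw.left_boundary s (hsub hs), Real.dist_eq, sub_zero] at h'
    exact h'.le
  · intro s hs
    have h' := h (s, 1 - δ) ⟨hs, by simpa using hδ1.le, by simpa using hδ.1.le⟩
      (s, 1) ⟨hs, by simp⟩ (by
      rw [Prod.dist_eq, dist_self, Real.dist_eq, sub_sub_cancel_left, abs_neg, abs_of_pos hδ.1]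
      exact max_lt hη hδη)
    simp only [hw.right_boundary s (hsub hs), Real.dist_eq, sub_zero] at h'
    exact h'.le

lemma eventually_sin_small (n : ℕ) {ε : ℝ} (hε : 0 < ε) : ∀ᶠ δ in nhdsWithin (0 : ℝ) (Ioi 0),
    |Real.sin (n * Real.pi * δ)| ≤ ε ∧ |Real.sin (n * Real.pi * (1 - δ))| ≤ ε := by
  have h₁ : Continuous fun δ : ℝ => |Real.sin (n * Real.pi * δ)| := by fun_prop
  have h₂ : Continuous fun δ : ℝ => |Real.sin (n * Real.pi * (1 - δ))| := by fun_prop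
  have h₁' := h₁.tendsto 0
  have h₂' := h₂.tendsto 0
  simp only [mul_zero, Real.sin_zero, abs_zero, sub_zero, mul_one, Real.sin_nat_mul_pi] at h₁' h₂'
  refine Filter.Eventually.filter_mono nhdsWithin_le_nhds ?_
  filter_upwards [h₁'.eventually_lt_const hε, h₂'.eventually_lt_const hε] with δ h h'
  exact ⟨h.le, h'.le⟩

lemma IsClassicalNudgedBurgers.exp_mul_normCoeff_eq
    (hw : IsClassicalNudgedBurgers ν T k obs w) (hν : 0 < ν)
    (hk : ∀ t ∈ Ioo 0 T, ∀ x ∈ Ioo (0 : ℝ) 1, k t x = 0) {κ : ℝ} (hκ : ν * κ = -1 / 2) (n : ℕ)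
    {α β : ℝ} (hα : 0 < α) (hαβ : α ≤ β) (hβ : β < T) {g h : L2Unit}
    (hg : (g : ℝ → ℝ) =ᵐ[volume.restrict (Ioo (0 : ℝ) 1)] w α)
    (hh : (h : ℝ → ℝ) =ᵐ[volume.restrict (Ioo (0 : ℝ) 1)] w β) :
    Real.exp (ν * (n * Real.pi) ^ 2 * β) * normCoeff κ n h
      = Real.exp (ν * (n * Real.pi) ^ 2 * α) * normCoeff κ n g := by
  obtain ⟨M, hM⟩ := exists_abs_le_on_rectangle (f := w) (α := α) (β := β) (a := 0) (b := 1)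
    hw.continuousOn (prod_mono (fun s hs => ⟨hα.trans_le hs.1, hs.2.trans hβ.le⟩) le_rfl)
  set C := Real.exp (ν * (n * Real.pi) ^ 2 * β) * (ν * ((4 * |κ| + 2 * (n * Real.pi)) *
        (2 * Real.exp (|κ| * M) ^ 2)))
  have hlim := ((hw.tendsto_coleHopfQuotient κ n ⟨hα.trans_le hαβ, hβ.le⟩ hh).sub
    (hw.tendsto_coleHopfQuotient κ n ⟨hα, hαβ.trans hβ.le⟩ hg)).abs
  have hle : ∀ ε > 0, |Real.exp (ν * (n * Real.pi) ^ 2 * β) * normCoeff κ n h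
      - Real.exp (ν * (n * Real.pi) ^ 2 * α) * normCoeff κ n g| ≤ C * ε * (β - α) := by
    intro ε hε
    refine le_of_tendsto hlim ?_
    -- The restriction `δ < 1/4` ensures that `[δ, 1 - δ]` has length at least `1/2`.
    filter_upwards [hw.eventually_boundary_small hα hβ.le hε, eventually_sin_small n hε,
      Ioo_mem_nhdsGT (show (0 : ℝ) < 1 / 4 by norm_num)] with δ h₁ h₂ h₃
    exact hw.abs_coleHopfQuotient_sub_le hν hk hκ n hα hαβ hβ h₃.1 (by linarith [h₃.2])
      (by linarith [h₃.1]) hM h₁.1 h₁.2 h₂.1 h₂.2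
  have hT : Filter.Tendsto (fun ε => C * ε * (β - α)) (nhdsWithin 0 (Ioi 0)) (nhds 0) := by
    have : Continuous fun ε => C * ε * (β - α) := by fun_prop
    have h' := this.tendsto 0
    simp only [mul_zero, zero_mul] at h'
    exact h'.mono_left nhdsWithin_le_nhds
  have h0 := ge_of_tendsto hT (Filter.eventually_of_mem self_mem_nhdsWithin hle)
  exact sub_eq_zero.1 (abs_nonpos_iff.1 h0)

/-- The conserved quantity is a continuous function of `u(t) ∈ L²`, so its constancy on `(0, T)`
passes to the closure. This brings in both `t = 0` and `t = T`. -/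
lemma SolvesNudgedBurgers.exp_mul_normCoeff_eq {u : Trajectory T} (hT : 0 < T) (hν : 0 < ν)
    (hu : SolvesNudgedBurgers ν T k obs u)
    (hk : ∀ t ∈ Ioo 0 T, ∀ x ∈ Ioo (0 : ℝ) 1, k t x = 0) {κ : ℝ} (hκ : ν * κ = -1 / 2) (n : ℕ)
    (s t : Icc (0 : ℝ) T) :
    Real.exp (ν * (n * Real.pi) ^ 2 * s) * normCoeff κ n (u s)
      = Real.exp (ν * (n * Real.pi) ^ 2 * t) * normCoeff κ n (u t) := by
  obtain ⟨w, hw, hwu⟩ := hu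
  let G : ℝ → ℝ := fun r => Real.exp (ν * (n * Real.pi) ^ 2 * r) *
    normCoeff κ n (u (projIcc 0 T hT.le r))
  have hG : Continuous G :=
    (by fun_prop : Continuous fun r : ℝ => Real.exp (ν * (n * Real.pi) ^ 2 * r)).mul
      ((continuous_normCoeff κ n).comp (u.continuous.comp continuous_projIcc))
  have hproj : ∀ r (hr : r ∈ Ioo 0 T),
      (u (projIcc 0 T hT.le r) : ℝ → ℝ) =ᵐ[volume.restrict (Ioo (0 : ℝ) 1)] w r := by
    intro r hr
    rw [projIcc_of_mem _ (Ioo_subset_Icc_self hr)]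
    exact hwu ⟨r, Ioo_subset_Icc_self hr⟩ hr.1
  have hle : ∀ r ∈ Ioo 0 T, ∀ r' ∈ Ioo 0 T, r ≤ r' → G r' = G r := fun r hr r' hr' hrr' =>
    hw.exp_mul_normCoeff_eq hν hk hκ n hr.1 hrr' hr'.2 (hproj r hr) (hproj r' hr')
  have hmid : T / 2 ∈ Ioo 0 T := ⟨by linarith, by linarith⟩
  have hEq : EqOn G (fun _ => G (T / 2)) (Ioo 0 T) := by
    intro r hr
    rcases le_total r (T / 2) with h | h
    · exact (hle r hr _ hmid h).symm
    · exact hle _ hmid r hr h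
  have hEq' := hEq.closure hG continuous_const
  rw [closure_Ioo hT.ne] at hEq'
  have hst := (hEq' s.2).trans (hEq' t.2).symm
  simpa only [G, projIcc_val] using hst

end Trajectory

/-! ### Recovering a function from its normalised coefficients; uniqueness and well-posedness -/

lemma primitive_injective : Function.Injective primitive := by
  rw [injective_iff_map_eq_zero]
  intro g hg
  refine Lp.ext ?_
  have h01 : (0 : ℝ) ∈ Icc (0 : ℝ) 1 := left_mem_Icc.2 zero_le_one
  have hae := (intervalIntegrable_L2Unit g h01 (right_mem_Icc.2 zero_le_one)).ae_hasDerivAt_integral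
  filter_upwards [ae_restrict_of_ae hae, ae_restrict_mem measurableSet_Ioo,
    Lp.coeFn_zero ℝ 2 (volume.restrict (Ioo (0 : ℝ) 1))] with x hx hxI h0
  rw [h0, Pi.zero_apply]
  rw [uIcc_of_le zero_le_one] at hx
  have hd := hx (Ioo_subset_Icc_self hxI) 0 h01
  have he : (fun y => ∫ z in (0 : ℝ)..y, g z) =ᶠ[nhds x] fun _ => 0 := by
    filter_upwards [Icc_mem_nhds hxI.1 hxI.2] with y hy
    have := congrArg (fun f : C(unitInterval, ℝ) => f ⟨y, hy⟩) hg
    exact this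
  exact (he.hasDerivAt_iff.1 hd).unique (hasDerivAt_const x 0)

/-- By completeness of the cosines, the coefficients determine the transform up to a positive
factor, and its value `1` at `x = 0` fixes that factor. The exponential and the primitive are
injective. -/
lemma eq_of_forall_normCoeff_eq {κ : ℝ} (hκ : κ ≠ 0) {g h : L2Unit}
    (hn : ∀ n, normCoeff κ n g = normCoeff κ n h) : g = h := by
  have hg := cosCoeff_zero_coleHopf_pos κ g
  have hh := cosCoeff_zero_coleHopf_pos κ h
  have h₁ : (cosCoeff 0 (coleHopf κ g))⁻¹ • coleHopf κ g
      = (cosCoeff 0 (coleHopf κ h))⁻¹ • coleHopf κ h := by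
    refine eq_of_forall_cosCoeff_eq fun n => ?_
    rw [map_smul, map_smul, smul_eq_mul, smul_eq_mul, inv_mul_eq_div, inv_mul_eq_div]
    exact hn n
  have hzero : ∀ f : L2Unit, coleHopf κ f 0 = 1 := fun f => by
    rw [coleHopf_apply, primitive_apply]
    simp
  have h₂ := congrArg (fun f : C(unitInterval, ℝ) => f 0) h₁
  simp only [ContinuousMap.smul_apply, hzero, smul_eq_mul, mul_one] at h₂
  rw [h₂] at h₁
  have h₃ := smul_right_injective _ (inv_ne_zero hh.ne') h₁
  refine primitive_injective (ContinuousMap.ext fun x => ?_)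
  have h₄ := congrArg (fun f : C(unitInterval, ℝ) => f x) h₃
  exact mul_left_cancel₀ hκ (Real.exp_injective h₄)

/-- The time `s` is arbitrary: `s = 0` gives forward uniqueness and `s = T` backward uniqueness. -/
lemma SolvesNudgedBurgers.eq_of_apply_eq {ν T : ℝ} (hT : 0 < T) (hν : 0 < ν)
    {k k' obs obs' : ℝ → ℝ → ℝ} {u v : Trajectory T} (hu : SolvesNudgedBurgers ν T k obs u)
    (hv : SolvesNudgedBurgers ν T k' obs' v)
    (hk : ∀ t ∈ Ioo 0 T, ∀ x ∈ Ioo (0 : ℝ) 1, k t x = 0)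
    (hk' : ∀ t ∈ Ioo 0 T, ∀ x ∈ Ioo (0 : ℝ) 1, k' t x = 0) {s : Icc (0 : ℝ) T}
    (hs : u s = v s) : u = v := by
  have hκ : ν * (-2 * ν)⁻¹ = -1 / 2 := by field_simp
  have hκ0 : (-2 * ν)⁻¹ ≠ 0 := inv_ne_zero (by linarith)
  ext1 t
  refine eq_of_forall_normCoeff_eq hκ0 fun n => ?_
  have h₁ := hu.exp_mul_normCoeff_eq hT hν hk hκ n s t
  have h₂ := hv.exp_mul_normCoeff_eq hT hν hk' hκ n s t
  rw [hs, h₂] at h₁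
  exact (mul_left_cancel₀ (Real.exp_pos _).ne' h₁).symm

theorem mainTheorem6 (ν T : ℝ) (hν : 0 < ν) (hT : 0 < T) (K K' uobs : ℝ → ℝ → ℝ)
    (hK : ∀ t ∈ Set.Icc 0 T, ∀ x ∈ Set.Icc (0 : ℝ) 1, K t x = 0)
    (hK' : ∀ t ∈ Set.Icc 0 T, ∀ x ∈ Set.Icc (0 : ℝ) 1, K' t x = 0) :
    HadamardWellPosed (IsBFNBurgersSolution ν T hT.le K K' uobs) ∧
      (∀ u₀ : L2Unit, ∃! p : Trajectory T × Trajectory T,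
        IsBFNBurgersSolution ν T hT.le K K' uobs u₀ p) ∧
      ∀ (u₀ : L2Unit) (u ut : Trajectory T),
        IsBFNBurgersSolution ν T hT.le K K' uobs u₀ (u, ut) → u = ut := by
  have hk : ∀ t ∈ Ioo 0 T, ∀ x ∈ Ioo (0 : ℝ) 1, K t x = 0 := fun t ht x hx =>
    hK t (Ioo_subset_Icc_self ht) x (Ioo_subset_Icc_self hx)
  have hk' : ∀ t ∈ Ioo 0 T, ∀ x ∈ Ioo (0 : ℝ) 1, -(K' t x) = 0 := fun t ht x hx => by
    rw [hK' t (Ioo_subset_Icc_self ht) x (Ioo_subset_Icc_self hx), neg_zero]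
  let U : L2Unit → Trajectory T := burgersTrajectory hν (-2 * ν)⁻¹ T
  have hU : Continuous U := continuous_burgersTrajectory hν _ T
  have hU0 : ∀ u₀, U u₀ ⟨0, left_mem_Icc.2 hT.le⟩ = u₀ := fun u₀ =>
    burgersFlow_zero hν _ (inv_ne_zero (by linarith)) u₀
  -- Both components solve the same equation and agree at `t = T`, so backward uniqueness identifies
  -- them.
  have heq : ∀ u₀ p, IsBFNBurgersSolution ν T hT.le K K' uobs u₀ p → p.2 = p.1 := fun u₀ p hp =>
    hp.backward.eq_of_apply_eq hT hν hp.forward hk' hk hp.final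
  have huniq : ∀ u₀ p, IsBFNBurgersSolution ν T hT.le K K' uobs u₀ p → p = (U u₀, U u₀) := by
    intro u₀ p hp
    have h₁ : p.1 = U u₀ := hp.forward.eq_of_apply_eq hT hν
      (solvesNudgedBurgers_burgersTrajectory (obs := uobs) hν hk u₀) hk hk
      (hp.initial.trans (hU0 u₀).symm)
    exact Prod.ext h₁ ((heq u₀ p hp).trans h₁)
  have hex : ∀ u₀, ∃! p : Trajectory T × Trajectory T,
      IsBFNBurgersSolution ν T hT.le K K' uobs u₀ p := fun u₀ =>
    ⟨(U u₀, U u₀), ⟨solvesNudgedBurgers_burgersTrajectory hν hk u₀, hU0 u₀,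
      solvesNudgedBurgers_burgersTrajectory hν hk' u₀, rfl⟩, huniq u₀⟩
  refine ⟨⟨hex, fun S hS => ?_⟩, hex, fun u₀ u ut h => (heq u₀ _ h).symm⟩
  have : S = fun u₀ => (U u₀, U u₀) := funext fun u₀ => huniq u₀ _ (hS u₀)
  rw [this]
  exact hU.prodMk hU
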